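/- **Setting.** Manifolds are smooth, finite-dimensional, Hausdorff and without boundary. Let $(\bar M,\bar g)$ be a semi-Riemannian manifold (smooth nondegenerate metric of constant index) with Levi-Civita connection $\bar\nabla$, and let $\bar J$ be a smooth $(1,1)$-tensor field on $\bar M$ such that $$\bar J^2=3\bar J+I,\qquad \bar g(X,\bar JY)=\bar g(\bar JX,Y),\qquad \bar\nabla\bar J=0,$$ i.e. $(\bar M,\bar g,\bar J)$ is a locally bronze semi-Riemannian manifold. Let $l,m$ be smooth functions on $\bar M$, $(l,m)\ne(0,0)$, let $\eta$ be a smooth vector field on $\bar M$ with $\bar g(\eta,\eta)=1$, put $\theta(Y)=\bar g(Y,\eta)$, and let $\bar\Omega$ be the $(l,m)$-type connection $$\bar\Omega_XY=\bar\nabla_XY+\theta(Y)\{lX+m\bar JX\}.$$ Let $M$ be an (immersed) $r$-lightlike submanifold of $\bar M$, $r>0$: the radical $\mathrm{Rad}\,TM=TM\cap TM^\perp$ is a smooth distribution of constant rank $r$. Fix smooth subbundles of $T\bar M|_M$: a screen distribution $S(TM)$ with $TM=\mathrm{Rad}\,TM\perp S(TM)$, a screen transversal bundle $S(TM^\perp)$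 with $TM^\perp=\mathrm{Rad}\,TM\perp S(TM^\perp)$, and a lightlike transversal bundle $\mathrm{ltr}(TM)$, i.e. a totally null complement of $\mathrm{Rad}\,TM$ in the orthogonal complement of $S(TM)\perp S(TM^\perp)$. Then $$T\bar M|_M=TM\oplus \mathrm{ltr}(TM)\oplus S(TM^\perp).$$ For $X,Y\in\Gamma(TM)$ write, according to this decomposition, $$\bar\Omega_XY=\Omega_XY+\bar h^l(X,Y)+\bar h^s(X,Y),$$ and let $fX$ be the tangential part of $\bar JX$. Write $g$ for the restriction of $\bar g$ to $T\bar M|_M$. Assume that $M$ is screen generic: $\bar J(\mathrm{Rad}\,TM)=\mathrm{Rad}\,TM$, and $B_o=\bar J(S(TM))\cap S(TM)$ is a smooth subbundle of $S(TM)$ on which $\bar g$ is nondegenerate. Let $B'$ be the orthogonal complement of $B_o$ in $S(TM)$, and let $B=B_o\perp \mathrm{Rad}\,TM$, which is $\bar J$-invariant. **Theorem.** The distribution $B$ is integrable, i.e. $[X,Y]\in\Gamma(B)$ for all $X,Y\in\Gamma(B)$, if and only if $$g(\Omega_X\bar JY,fZ)+g(\bar h^s(X,\bar JY),\bar JZ)+3g(\Omega_Y\bar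 JX,Z)=g(\Omega_Y\bar JX,fZ)+g(\bar h^s(Y,\bar JX),\bar JZ)+3g(\Omega_X\bar JY,Z)$$ for all $X,Y\in\Gamma(B)$ and all $Z\in\Gamma(B')$. -/

import Mathlib

open scoped Manifold ContDiff Topology
open Bundle Set

namespace BronzeLightlike

section Ambient

variable {E : Type*} [NormedAddCommGroup E] [NormedSpace ℝ E] [FiniteDimensional ℝ E]
  {N : Type*} [TopologicalSpace N] [ChartedSpace E N] [IsManifold 𝓘(ℝ, E) ∞ N]

/-- A smooth vector field on `N`. -/
def IsSmoothField (X : ∀ x : N, TangentSpace 𝓘(ℝ, E) x) : Prop :=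
  ContMDiff 𝓘(ℝ, E) 𝓘(ℝ, E).tangent ∞ fun x ↦ (⟨x, X x⟩ : TangentBundle 𝓘(ℝ, E) N)

/-- The index of a symmetric bilinear form is `q`: the largest dimension of a subspace on which
the form is negative definite. -/
def HasIndex {V : Type*} [AddCommGroup V] [Module ℝ V] (b : LinearMap.BilinForm ℝ V) (q : ℕ) :
    Prop :=
  IsGreatest {k : ℕ | ∃ W : Submodule ℝ V, Module.finrank ℝ W = k ∧ ∀ w ∈ W, w ≠ 0 → b w w < 0} q

variable (E N) in
/-- A semi-Riemannian metric: a smooth symmetric nondegenerate `(0,2)`-tensor field of constant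
index. -/
structure SemiRiemannianMetric where
  inner (x : N) : TangentSpace 𝓘(ℝ, E) x →L[ℝ] TangentSpace 𝓘(ℝ, E) x →L[ℝ] ℝ
  symm (x : N) (v w : TangentSpace 𝓘(ℝ, E) x) : inner x v w = inner x w v
  nondegenerate (x : N) (v : TangentSpace 𝓘(ℝ, E) x) : (∀ w, inner x v w = 0) → v = 0
  contMDiff : ContMDiff 𝓘(ℝ, E) (𝓘(ℝ, E).prod 𝓘(ℝ, E →L[ℝ] E →L[ℝ] ℝ)) ∞
    fun x ↦ TotalSpace.mk' (E →L[ℝ] E →L[ℝ] ℝ)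
      (E := fun x : N ↦ TangentSpace 𝓘(ℝ, E) x →L[ℝ] TangentSpace 𝓘(ℝ, E) x →L[ℝ] ℝ) x (inner x)
  index : ℕ
  hasIndex (x : N) : HasIndex (inner x).toBilinForm index

/-- The metric at `x` as a bilinear form. -/
noncomputable def SemiRiemannianMetric.form (g : SemiRiemannianMetric E N) (x : N) :
    LinearMap.BilinForm ℝ (TangentSpace 𝓘(ℝ, E) x) :=
  (g.inner x).toBilinForm

/-- A linear connection on `N`; `nabla Y x v` is the covariant derivative of the vector field `Y`
at `x` in the direction `v`. -/
abbrev Connection (E : Type*) [NormedAddCommGroup E] [NormedSpace ℝ E]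
    (N : Type*) [TopologicalSpace N] [ChartedSpace E N] [IsManifold 𝓘(ℝ, E) ∞ N] :=
  CovariantDerivative 𝓘(ℝ, E) E (TangentSpace 𝓘(ℝ, E) : N → Type _)

/-- `nabla` is the Levi-Civita connection of `g`: the torsion-free metric connection. -/
structure IsLeviCivita (g : SemiRiemannianMetric E N) (nabla : Connection E N) : Prop where
  torsion_eq_zero : nabla.torsion = 0
  metric (Y Z : ∀ x : N, TangentSpace 𝓘(ℝ, E) x) (x : N) (v : TangentSpace 𝓘(ℝ, E) x) :
    MDiffAt (T% Y) x → MDiffAt (T% Z) x →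
      mvfderiv 𝓘(ℝ, E) (fun y ↦ g.inner y (Y y) (Z y)) x v =
        g.inner x (nabla Y x v) (Z x) + g.inner x (Y x) (nabla Z x v)

variable (E N) in
/-- A smooth `(1,1)`-tensor field. -/
structure EndField where
  toFun (x : N) : TangentSpace 𝓘(ℝ, E) x →L[ℝ] TangentSpace 𝓘(ℝ, E) x
  contMDiff : ContMDiff 𝓘(ℝ, E) (𝓘(ℝ, E).prod 𝓘(ℝ, E →L[ℝ] E)) ∞
    fun x ↦ TotalSpace.mk' (E →L[ℝ] E)
      (E := fun x : N ↦ TangentSpace 𝓘(ℝ, E) x →L[ℝ] TangentSpace 𝓘(ℝ, E) x) x (toFun x)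

instance : CoeFun (EndField E N)
    fun _ ↦ ∀ x : N, TangentSpace 𝓘(ℝ, E) x →L[ℝ] TangentSpace 𝓘(ℝ, E) x :=
  ⟨EndField.toFun⟩

/-- `(g, J)` is a bronze semi-Riemannian structure. -/
structure IsBronze (g : SemiRiemannianMetric E N) (J : EndField E N) : Prop where
  sq (x : N) (v : TangentSpace 𝓘(ℝ, E) x) : J x (J x v) = (3 : ℝ) • J x v + v
  compatible (x : N) (v w : TangentSpace 𝓘(ℝ, E) x) : g.inner x v (J x w) = g.inner x (J x v) w

/-- `(N, g, J)` is a locally bronze semi-Riemannian manifold: `(g, J)` is a bronze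
semi-Riemannian structure and `J` is parallel for the Levi-Civita connection `nabla`. -/
structure IsLocallyBronze (g : SemiRiemannianMetric E N) (J : EndField E N)
    (nabla : Connection E N) : Prop where
  isBronze : IsBronze g J
  isLeviCivita : IsLeviCivita g nabla
  parallel (Y : ∀ x : N, TangentSpace 𝓘(ℝ, E) x) (x : N) (v : TangentSpace 𝓘(ℝ, E) x) :
    MDiffAt (T% Y) x → nabla (fun y ↦ J y (Y y)) x v = J x (nabla Y x v)

variable (E N) in
/-- The data `l`, `m`, `η` of an `(l,m)`-type connection: smooth functions `l` and `m`, not both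
identically zero, and a smooth unit spacelike vector field `η`. -/
structure LMData (g : SemiRiemannianMetric E N) where
  l : N → ℝ
  m : N → ℝ
  eta : ∀ x : N, TangentSpace 𝓘(ℝ, E) x
  l_smooth : ContMDiff 𝓘(ℝ, E) 𝓘(ℝ, ℝ) ∞ l
  m_smooth : ContMDiff 𝓘(ℝ, E) 𝓘(ℝ, ℝ) ∞ m
  lm_ne_zero : (l, m) ≠ (0, 0)
  eta_smooth : IsSmoothField eta
  eta_unit (x : N) : g.inner x (eta x) (eta x) = 1

/-- The 1-form `θ(Y) = g(η, Y) = g(Y, η)`. -/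
noncomputable def LMData.theta {g : SemiRiemannianMetric E N} (d : LMData E N g) (x : N) :
    TangentSpace 𝓘(ℝ, E) x →L[ℝ] ℝ :=
  g.inner x (d.eta x)

/-- The `(l,m)`-type connection `Ω_X Y = ∇_X Y + θ(Y) (l X + m J X)`. -/
noncomputable def LMData.connection {g : SemiRiemannianMetric E N} (d : LMData E N g)
    (J : EndField E N) (nabla : Connection E N) : Connection E N :=
  nabla.addOneForm fun x ↦
    (d.theta x).smulRight (d.l x • ContinuousLinearMap.id ℝ _ + d.m x • J x)

theorem LMData.connection_apply {g : SemiRiemannianMetric E N} (d : LMData E N g)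
    (J : EndField E N) (nabla : Connection E N) (Y : ∀ x : N, TangentSpace 𝓘(ℝ, E) x) (x : N)
    (v : TangentSpace 𝓘(ℝ, E) x) :
    d.connection J nabla Y x v =
      nabla Y x v + g.inner x (Y x) (d.eta x) • (d.l x • v + d.m x • J x v) := by
  rw [g.symm]
  rfl

end Ambient

section Submanifold

variable {E : Type*} [NormedAddCommGroup E] [NormedSpace ℝ E] [FiniteDimensional ℝ E]
  {N : Type*} [TopologicalSpace N] [ChartedSpace E N] [IsManifold 𝓘(ℝ, E) ∞ N]
  {F : Type*} [NormedAddCommGroup F] [NormedSpace ℝ F] [FiniteDimensional ℝ F]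
  {M : Type*} [TopologicalSpace M] [ChartedSpace F M] [IsManifold 𝓘(ℝ, F) ∞ M]

/-- Vector fields along `i : M → N`, that is, (set-theoretic) sections of `TN|_M`. -/
abbrev FieldAlong (E : Type*) [NormedAddCommGroup E] [NormedSpace ℝ E]
    {N : Type*} [TopologicalSpace N] [ChartedSpace E N] {M : Type*} (i : M → N) :=
  ∀ p : M, TangentSpace 𝓘(ℝ, E) (i p)

/-- A choice of a subspace of `TN|_M` over every point of `M`. -/
abbrev Distribution (E : Type*) [NormedAddCommGroup E] [NormedSpace ℝ E]
    {N : Type*} [TopologicalSpace N] [ChartedSpace E N] {M : Type*} (i : M → N) :=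
  ∀ p : M, Submodule ℝ (TangentSpace 𝓘(ℝ, E) (i p))

variable (F) in
/-- Smoothness on a set `U` of a vector field along `i`. -/
def IsSmoothAlongOn {i : M → N} (V : FieldAlong E i) (U : Set M) : Prop :=
  ContMDiffOn 𝓘(ℝ, F) 𝓘(ℝ, E).tangent ∞ (fun p ↦ (⟨i p, V p⟩ : TangentBundle 𝓘(ℝ, E) N)) U

variable (F) in
/-- `D` is a smooth vector subbundle of `TN|_M`: it has smooth local frames. -/
def IsSmoothSubbundle {i : M → N} (D : Distribution E i) : Prop :=
  ∀ p, ∃ U ∈ 𝓝 p, ∃ k : ℕ, ∃ s : Fin k → FieldAlong E i,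
    (∀ j, IsSmoothAlongOn F (s j) U) ∧
    ∀ q ∈ U, LinearIndependent ℝ (fun j ↦ s j q) ∧ Submodule.span ℝ (range fun j ↦ s j q) = D q

variable (F) in
/-- `V ∈ Γ(D)`: `V` is a smooth section of `D`. -/
def IsSection {i : M → N} (D : Distribution E i) (V : FieldAlong E i) : Prop :=
  IsSmoothAlongOn F V univ ∧ ∀ p, V p ∈ D p

variable (E) in
/-- A vector field on `M`, seen as a vector field along `i`. -/
noncomputable def push (i : M → N) (X : ∀ p : M, TangentSpace 𝓘(ℝ, F) p) : FieldAlong E i :=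
  fun p ↦ mfderiv 𝓘(ℝ, F) 𝓘(ℝ, E) i p (X p)

variable (E F) in
/-- `TM`, as a subbundle of `TN|_M`. -/
noncomputable def tangent (i : M → N) : Distribution E i :=
  fun p ↦ (mfderiv 𝓘(ℝ, F) 𝓘(ℝ, E) i p).range

/-- The fibrewise orthogonal `D^⊥`. -/
noncomputable def perp (g : SemiRiemannianMetric E N) {i : M → N} (D : Distribution E i) :
    Distribution E i :=
  fun p ↦ (g.form (i p)).orthogonal (D p)

variable (F) in
/-- The radical `Rad TM = TM ∩ TM^⊥`. -/
noncomputable def rad (g : SemiRiemannianMetric E N) (i : M → N) : Distribution E i :=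
  fun p ↦ tangent E F i p ⊓ perp g (tangent E F i) p

variable (F) in
/-- `i : M → N` makes `M` an `r`-lightlike submanifold of `(N, g)`. -/
structure IsLightlike (g : SemiRiemannianMetric E N) (i : M → N) (r : ℕ) : Prop where
  isImmersion : Manifold.IsImmersion 𝓘(ℝ, F) 𝓘(ℝ, E) ∞ i
  rank_pos : 0 < r
  rad_smooth : IsSmoothSubbundle F (rad F g i)
  rad_rank (p : M) : Module.finrank ℝ (rad F g i p) = r

variable (F) in
/-- The data `(S(TM), S(TM^⊥), ltr(TM))` of a lightlike submanifold. -/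
structure ScreenData (g : SemiRiemannianMetric E N) (i : M → N) where
  /-- The screen distribution `S(TM)`, a complement of `Rad TM` in `TM`. -/
  screen : Distribution E i
  screen_smooth : IsSmoothSubbundle F screen
  disjoint_screen (p : M) : Disjoint (rad F g i p) (screen p)
  sup_screen (p : M) : rad F g i p ⊔ screen p = tangent E F i p
  /-- The screen transversal bundle `S(TM^⊥)`, a complement of `Rad TM` in `TM^⊥`. -/
  screenTrans : Distribution E i
  screenTrans_smooth : IsSmoothSubbundle F screenTrans
  disjoint_screenTrans (p : M) : Disjoint (rad F g i p) (screenTrans p)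
  sup_screenTrans (p : M) : rad F g i p ⊔ screenTrans p = perp g (tangent E F i) p
  /-- The lightlike transversal bundle `ltr(TM)`, a totally null complement of `Rad TM` in the
  orthogonal of `S(TM) ⊥ S(TM^⊥)`. -/
  ltr : Distribution E i
  ltr_smooth : IsSmoothSubbundle F ltr
  disjoint_ltr (p : M) : Disjoint (rad F g i p) (ltr p)
  sup_ltr (p : M) : rad F g i p ⊔ ltr p = perp g (fun q ↦ screen q ⊔ screenTrans q) p
  ltr_null (p : M) : ∀ v ∈ ltr p, ∀ w ∈ ltr p, g.inner (i p) v w = 0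

/-- The algebraic part of the decomposition `TN|_M = TM ⊕ ltr(TM) ⊕ S(TM^⊥)`. -/
theorem isCompl_of_screen {V : Type*} [AddCommGroup V] [Module ℝ V] [FiniteDimensional ℝ V]
    {B : LinearMap.BilinForm ℝ V} (hB : B.Nondegenerate) (hs : B.IsSymm)
    {T S P L : Submodule ℝ V}
    (hS : Disjoint (T ⊓ B.orthogonal T) S) (hS' : T ⊓ B.orthogonal T ⊔ S = T)
    (hP : Disjoint (T ⊓ B.orthogonal T) P) (hP' : T ⊓ B.orthogonal T ⊔ P = B.orthogonal T)
    (hL : Disjoint (T ⊓ B.orthogonal T) L)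
    (hL' : T ⊓ B.orthogonal T ⊔ L = B.orthogonal (S ⊔ P)) :
    IsCompl T (L ⊔ P) ∧ IsCompl P (T ⊔ L) := by
  have hr : B.IsRefl := hs.isRefl
  have hST : S ≤ T := hS' ▸ le_sup_right
  have hPT : P ≤ B.orthogonal T := hP' ▸ le_sup_right
  have hTT : B.orthogonal (B.orthogonal T) = T :=
    LinearMap.BilinForm.orthogonal_orthogonal hB hr T
  have hL1 : L ≤ B.orthogonal (S ⊔ P) := hL' ▸ le_sup_right
  have hR1 : T ⊓ B.orthogonal T ≤ B.orthogonal (S ⊔ P) := hL' ▸ le_sup_left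
  -- `S ⊥ P` is nondegenerate
  have hU : Disjoint (S ⊔ P) (B.orthogonal (S ⊔ P)) := by
    rw [Submodule.disjoint_def]
    intro v hv hv'
    obtain ⟨a, ha, b, hb, rfl⟩ := Submodule.mem_sup.1 hv
    have haS : ∀ s ∈ S, B s a = 0 := fun s h ↦ by
      have h1 := hv' s (Submodule.mem_sup_left h)
      have h2 : B s b = 0 := hPT hb s (hST h)
      simpa [h2] using h1
    have hbP : ∀ s ∈ P, B s b = 0 := fun s h ↦ by
      have h1 := hv' s (Submodule.mem_sup_right h)
      have h2 : B s a = 0 := hr _ _ (hPT h a (hST ha))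
      simpa [h2] using h1
    have ha0 : a = 0 := by
      refine Submodule.disjoint_def.1 hS a ⟨hST ha, fun n hn ↦ ?_⟩ ha
      rw [← hS'] at hn
      obtain ⟨c, hc, s, h, rfl⟩ := Submodule.mem_sup.1 hn
      have h1 : B c a = 0 := hr _ _ (hc.2 a (hST ha))
      simpa [h1] using haS s h
    have hb0 : b = 0 := by
      refine Submodule.disjoint_def.1 hP b ⟨?_, hPT hb⟩ hb
      rw [← hTT]
      intro n hn
      rw [← hP'] at hn
      obtain ⟨c, hc, s, h, rfl⟩ := Submodule.mem_sup.1 hn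
      have h1 : B c b = 0 := hPT hb c hc.1
      simpa [h1] using hbP s h
    simp [ha0, hb0]
  have hSP : Disjoint S P := by
    rw [Submodule.disjoint_def]
    intro v hv hv'
    refine Submodule.disjoint_def.1 hS v ⟨hST hv, hPT hv'⟩ hv
  have htop : T ⊔ (L ⊔ P) = ⊤ := by
    have h1 := ((LinearMap.BilinForm.isCompl_orthogonal_iff_disjoint hr).2 hU).sup_eq_top
    rw [← hL'] at h1
    refine top_le_iff.1 (h1 ▸ ?_)
    refine sup_le (sup_le (hST.trans le_sup_left) ?_) (sup_le (inf_le_left.trans le_sup_left) ?_)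
    · exact le_sup_right.trans le_sup_right
    · exact le_sup_left.trans le_sup_right
  have key : ∀ ξ ∈ T ⊓ B.orthogonal T, ∀ s ∈ S, ∀ n ∈ L, ∀ w ∈ P, ξ + s = n + w →
      ξ = 0 ∧ s = 0 ∧ n = 0 ∧ w = 0 := by
    intro ξ hξ s h n hn w hw e
    have h1 : s - w = 0 := by
      refine Submodule.disjoint_def.1 hU _
        (sub_mem (Submodule.mem_sup_left h) (Submodule.mem_sup_right hw)) ?_
      have : s - w = n - ξ := by
        rw [sub_eq_sub_iff_add_eq_add, add_comm s ξ, e]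
      rw [this]
      exact sub_mem (hL1 hn) (hR1 hξ)
    have h2 : s = w := sub_eq_zero.1 h1
    subst h2
    have h3 : ξ = n := add_right_cancel e
    subst h3
    exact ⟨Submodule.disjoint_def.1 hL _ hξ hn, Submodule.disjoint_def.1 hSP _ h hw,
      Submodule.disjoint_def.1 hL _ hξ hn, Submodule.disjoint_def.1 hSP _ h hw⟩
  have key' : ∀ t ∈ T, ∀ n ∈ L, ∀ w ∈ P, t = n + w → t = 0 ∧ n = 0 ∧ w = 0 := by
    intro t ht n hn w hw e
    rw [← hS'] at ht
    obtain ⟨ξ, hξ, s, h, rfl⟩ := Submodule.mem_sup.1 ht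
    obtain ⟨h1, h2, h3, h4⟩ := key ξ hξ s h n hn w hw e
    exact ⟨by simp [h1, h2], h3, h4⟩
  refine ⟨⟨?_, codisjoint_iff.2 htop⟩, ⟨?_, codisjoint_iff.2 ?_⟩⟩
  · rw [Submodule.disjoint_def]
    intro v hv hv'
    obtain ⟨n, hn, w, hw, rfl⟩ := Submodule.mem_sup.1 hv'
    exact (key' _ hv n hn w hw rfl).1
  · rw [Submodule.disjoint_def]
    intro v hv hv'
    obtain ⟨t, ht, n, hn, rfl⟩ := Submodule.mem_sup.1 hv'
    obtain ⟨h1, h2, -⟩ := key' t ht (-n) (neg_mem hn) _ hv (by abel)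
    simp [h1, neg_eq_zero.1 h2]
  · rw [← htop]
    ac_rfl

theorem ScreenData.isCompl {g : SemiRiemannianMetric E N} {i : M → N} (S : ScreenData F g i)
    (p : M) :
    IsCompl (tangent E F i p) (S.ltr p ⊔ S.screenTrans p) ∧
      IsCompl (S.screenTrans p) (tangent E F i p ⊔ S.ltr p) := by
  have hs : (g.form (i p)).IsSymm := ⟨fun v w ↦ g.symm (i p) v w⟩
  have : FiniteDimensional ℝ (TangentSpace 𝓘(ℝ, E) (i p)) := inferInstanceAs (FiniteDimensional ℝ E)
  refine isCompl_of_screen (B := g.form (i p)) ?_ hs (S.disjoint_screen p) (S.sup_screen p)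
    (S.disjoint_screenTrans p) (S.sup_screenTrans p) (S.disjoint_ltr p) (S.sup_ltr p)
  refine ⟨fun v hv ↦ g.nondegenerate (i p) v hv, fun v hv ↦ g.nondegenerate (i p) v fun w ↦ ?_⟩
  rw [g.symm]
  exact hv w

/-- The projection of `TN|_M = TM ⊕ ltr(TM) ⊕ S(TM^⊥)` onto `TM`. -/
noncomputable def ScreenData.tanProj {g : SemiRiemannianMetric E N} {i : M → N}
    (S : ScreenData F g i) (p : M) :
    TangentSpace 𝓘(ℝ, E) (i p) →ₗ[ℝ] TangentSpace 𝓘(ℝ, E) (i p) :=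
  Submodule.projection _ _ (S.isCompl p).1

/-- The projection of `TN|_M = TM ⊕ ltr(TM) ⊕ S(TM^⊥)` onto `S(TM^⊥)`. -/
noncomputable def ScreenData.screenTransProj {g : SemiRiemannianMetric E N} {i : M → N}
    (S : ScreenData F g i) (p : M) :
    TangentSpace 𝓘(ℝ, E) (i p) →ₗ[ℝ] TangentSpace 𝓘(ℝ, E) (i p) :=
  Submodule.projection _ _ (S.isCompl p).2

/-- The pullback of a connection along `i : M → N`: the covariant derivative of a vector field
`V` along `i`. Write `V` in the trivialization of `TN` around `i p` as an `E`-valued function `c`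
on `M`, and let `C` be the local vector field on `N` that is constant in this trivialization and
has the value `V p` at `i p`. By the Leibniz rule the derivative at `p` in the direction `v` is
`dc_p(v) + ∇_{di(v)} C`. -/
noncomputable def pullbackConnection (nabla : Connection E N) (i : M → N) (V : FieldAlong E i)
    (p : M) : TangentSpace 𝓘(ℝ, F) p →L[ℝ] TangentSpace 𝓘(ℝ, E) (i p) :=
  letI e := trivializationAt E (TangentSpace 𝓘(ℝ, E) : N → Type _) (i p)
  (e.symmL ℝ (i p)).comp
      (mvfderiv 𝓘(ℝ, F) (fun q ↦ (e (⟨i q, V q⟩ : TangentBundle 𝓘(ℝ, E) N)).2) p) +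
    (nabla (FiberBundle.extend E (V p)) (i p)).comp (mfderiv 𝓘(ℝ, F) 𝓘(ℝ, E) i p)

/-- Leibniz rule for a finite sum. -/
theorem connection_sum (nabla : Connection E N) {ι : Type*} (t : Finset ι) (c : ι → N → ℝ)
    (s : ι → ∀ x : N, TangentSpace 𝓘(ℝ, E) x) (x : N) (hc : ∀ j, MDiffAt (c j) x)
    (hs : ∀ j, MDiffAt (T% (s j)) x) :
    MDiffAt (T% (fun y ↦ ∑ j ∈ t, c j y • s j y)) x ∧
    nabla (fun y ↦ ∑ j ∈ t, c j y • s j y) x =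
      ∑ j ∈ t, (c j x • nabla (s j) x + (mvfderiv 𝓘(ℝ, E) (c j) x).smulRight (s j x)) := by
  classical
  induction t using Finset.induction_on with
  | empty =>
    simp only [Finset.sum_empty]
    exact ⟨mdifferentiableAt_zeroSection .., congr_fun nabla.zero x⟩
  | insert a t ha ih =>
    simp only [Finset.sum_insert ha]
    have h1 : MDiffAt (T% (fun y ↦ c a y • s a y)) x := (hc a).smul_section (hs a)
    refine ⟨mdifferentiableAt_add_section h1 ih.1, ?_⟩
    have h2 := nabla.isCovariantDerivativeOnUniv.add h1 ih.1
    have h3 := nabla.isCovariantDerivativeOnUniv.leibniz (hs a) (hc a)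
    rw [← ih.2]
    exact h2.trans (congrArg (· + _) h3)

/-- The pullback connection is characterized by extensions: if `V` is the restriction of a vector
field `W` on `N`, then the derivative of `V` in the direction `v` is `∇_{di(v)} W`. -/
theorem pullbackConnection_comp (nabla : Connection E N) (i : M → N)
    (W : ∀ x : N, TangentSpace 𝓘(ℝ, E) x) (p : M) (hi : MDifferentiableAt 𝓘(ℝ, F) 𝓘(ℝ, E) i p)
    (hW : MDiffAt (T% W) (i p)) :
    pullbackConnection nabla i (fun q ↦ W (i q)) p =
      (nabla W (i p)).comp (mfderiv 𝓘(ℝ, F) 𝓘(ℝ, E) i p) := by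
  set e := trivializationAt E (TangentSpace 𝓘(ℝ, E) : N → Type _) (i p) with he
  have hx : i p ∈ e.baseSet := FiberBundle.mem_baseSet_trivializationAt' (i p)
  let b := Module.finBasis ℝ E
  let u : N → E := fun y ↦ (e (⟨y, W y⟩ : TangentBundle 𝓘(ℝ, E) N)).2
  have hu : MDifferentiableAt 𝓘(ℝ, E) 𝓘(ℝ, E) u (i p) :=
    (e.mdifferentiableAt_section_iff 𝓘(ℝ, E) W hx).1 hW
  let L : Fin (Module.finrank ℝ E) → E →L[ℝ] ℝ := fun j ↦ (b.coord j).toContinuousLinearMap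
  let c : Fin (Module.finrank ℝ E) → N → ℝ := fun j y ↦ L j (u y)
  have hLd : ∀ j, MDifferentiableAt 𝓘(ℝ, E) 𝓘(ℝ, ℝ) (L j) (u (i p)) := fun j ↦
    (L j).differentiableAt.mdifferentiableAt
  have hc : ∀ j, MDifferentiableAt 𝓘(ℝ, E) 𝓘(ℝ, ℝ) (c j) (i p) := fun j ↦ (hLd j).comp (i p) hu
  let s : Fin (Module.finrank ℝ E) → ∀ x : N, TangentSpace 𝓘(ℝ, E) x := fun j y ↦ e.symm y (b j)
  have hs : ∀ j, MDiffAt (T% (s j)) (i p) := fun j ↦ by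
    rw [e.mdifferentiableAt_section_iff 𝓘(ℝ, E) _ hx]
    refine (mdifferentiableAt_const (c := b j)).congr_of_eventuallyEq ?_
    filter_upwards [e.open_baseSet.mem_nhds hx] with y hy
    simp [s, e.apply_mk_symm hy]
  have hsymm : ∀ y ∈ e.baseSet, ∀ w : E, e.symm y w = ∑ j, L j w • s j y := by
    intro y hy w
    conv_lhs => rw [← b.sum_repr w]
    rw [← e.symmL_apply (R := ℝ) hy, map_sum]
    refine Finset.sum_congr rfl fun j _ ↦ ?_
    rw [map_smul, e.symmL_apply (R := ℝ) hy]
    rfl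
  have hW' : ∀ᶠ y in 𝓝 (i p), W y = ∑ j, c j y • s j y := by
    filter_upwards [e.open_baseSet.mem_nhds hx] with y hy
    rw [← hsymm y hy]
    exact (e.symm_apply_apply_mk hy (W y)).symm
  have hC : ∀ᶠ y in 𝓝 (i p),
      FiberBundle.extend E (W (i p)) y = ∑ j, c j (i p) • s j y := by
    filter_upwards [e.open_baseSet.mem_nhds hx] with y hy
    exact hsymm y hy _
  have e1 := connection_sum nabla Finset.univ c s (i p) hc hs
  have e2 := connection_sum nabla Finset.univ (fun j _ ↦ c j (i p)) s (i p)
    (fun j ↦ mdifferentiableAt_const) hs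
  have f1 := nabla.isCovariantDerivativeOnUniv.congr_of_eventuallyEq hW e1.1
    Filter.univ_mem hW'
  have f2 := nabla.isCovariantDerivativeOnUniv.congr_of_eventuallyEq
    (FiberBundle.mdifferentiableAt_extend 𝓘(ℝ, E) E (W (i p))) e2.1 Filter.univ_mem hC
  have f1' := f1.trans e1.2
  have f2' := f2.trans e2.2
  ext v
  set v' := mfderiv 𝓘(ℝ, F) 𝓘(ℝ, E) i p v with hv'
  have hd : mvfderiv 𝓘(ℝ, F) (fun q ↦ u (i q)) p v = mvfderiv 𝓘(ℝ, E) u (i p) v' := by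
    have := mfderiv_comp p hu hi
    exact congrArg (fun A ↦ A v) this
  have hdc : ∀ j, mvfderiv 𝓘(ℝ, E) (c j) (i p) v' = L j (mvfderiv 𝓘(ℝ, E) u (i p) v') := by
    intro j
    have := mfderiv_comp (i p) (hLd j) hu
    rw [mfderiv_eq_fderiv, (L j).fderiv] at this
    exact congrArg (fun A ↦ A v') this
  have hA : pullbackConnection nabla i (fun q ↦ W (i q)) p v =
      e.symm (i p) (mvfderiv 𝓘(ℝ, F) (fun q ↦ u (i q)) p v) +
        nabla (FiberBundle.extend E (W (i p))) (i p) v' := by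
    rw [← e.symmL_apply (R := ℝ) hx]
    rfl
  have hB : ((nabla W (i p)).comp (mfderiv 𝓘(ℝ, F) 𝓘(ℝ, E) i p)) v = nabla W (i p) v' := rfl
  have f1'' := congrArg (fun A ↦ A v') f1'
  have f2'' := congrArg (fun A ↦ A v') f2'
  rw [hA, hB, hd, hsymm _ hx]
  refine (congrArg (_ + ·) f2'').trans (Eq.trans ?_ f1''.symm)
  simp only [mvfderiv_const, sum_apply, add_apply,
    smul_apply, ContinuousLinearMap.smulRight_apply, hdc,
    zero_apply, zero_smul, Finset.sum_add_distrib, Finset.sum_const_zero]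
  exact (congrArg _ (add_zero _)).trans (add_comm _ _)

/-- The induced connection `Ω_X V`: the tangential part of the derivative of `V` along `X` for the
connection `Om` of `N`, for a tangential `V`. -/
noncomputable def ScreenData.induced {g : SemiRiemannianMetric E N} {i : M → N}
    (S : ScreenData F g i) (Om : Connection E N) (X : ∀ p : M, TangentSpace 𝓘(ℝ, F) p)
    (V : FieldAlong E i) : FieldAlong E i :=
  fun p ↦ S.tanProj p (pullbackConnection Om i V p (X p))

/-- The screen second fundamental form `h^s(X, V)`: the `S(TM^⊥)`-part of the derivative
of `V` along `X` for the connection `Om` of `N`, for a tangential `V`. -/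
noncomputable def ScreenData.hs {g : SemiRiemannianMetric E N} {i : M → N}
    (S : ScreenData F g i) (Om : Connection E N) (X : ∀ p : M, TangentSpace 𝓘(ℝ, F) p)
    (V : FieldAlong E i) : FieldAlong E i :=
  fun p ↦ S.screenTransProj p (pullbackConnection Om i V p (X p))

/-- `J V` for a vector field `V` along `i`. -/
noncomputable def EndField.along (J : EndField E N) {i : M → N} (V : FieldAlong E i) :
    FieldAlong E i :=
  fun p ↦ J (i p) (V p)

/-- `f V`, the tangential part of `J V`. -/
noncomputable def ScreenData.f {g : SemiRiemannianMetric E N} {i : M → N}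
    (S : ScreenData F g i) (J : EndField E N) (V : FieldAlong E i) : FieldAlong E i :=
  fun p ↦ S.tanProj p (J (i p) (V p))

/-- The distribution `B_o = J(S(TM)) ∩ S(TM)`. -/
noncomputable def ScreenData.Bo {g : SemiRiemannianMetric E N} {i : M → N}
    (S : ScreenData F g i) (J : EndField E N) : Distribution E i :=
  fun p ↦ (S.screen p).map (J (i p)).toLinearMap ⊓ S.screen p

/-- The distribution `B'`, the orthogonal complement of `B_o` in `S(TM)`. -/
noncomputable def ScreenData.B' {g : SemiRiemannianMetric E N} {i : M → N}
    (S : ScreenData F g i) (J : EndField E N) : Distribution E i :=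
  fun p ↦ S.screen p ⊓ perp g (S.Bo J) p

/-- The invariant distribution `B = B_o ⊥ Rad TM`. -/
noncomputable def ScreenData.B {g : SemiRiemannianMetric E N} {i : M → N}
    (S : ScreenData F g i) (J : EndField E N) : Distribution E i :=
  fun p ↦ S.Bo J p ⊔ rad F g i p

/-- `M` is screen generic: `Rad TM` is `J`-invariant, and `B_o` is a nondegenerate smooth subbundle
of `S(TM)`. -/
structure ScreenData.IsScreenGeneric {g : SemiRiemannianMetric E N} {i : M → N}
    (S : ScreenData F g i) (J : EndField E N) : Prop where
  rad_invariant (p : M) : (rad F g i p).map (J (i p)).toLinearMap = rad F g i p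
  Bo_smooth : IsSmoothSubbundle F (S.Bo J)
  Bo_nondegenerate (p : M) : Disjoint (S.Bo J p) (perp g (S.Bo J) p)

variable (F) in
/-- A distribution `D ⊆ TM` is integrable (involutive): `[X, Y] ∈ Γ(D)` for `X, Y ∈ Γ(D)`. -/
def IsIntegrable {i : M → N} (D : Distribution E i) : Prop :=
  ∀ X Y : ∀ p : M, TangentSpace 𝓘(ℝ, F) p, IsSmoothField X → IsSmoothField Y →
    IsSection F D (push E i X) → IsSection F D (push E i Y) →
      ∀ p, push E i (VectorField.mlieBracket 𝓘(ℝ, F) X Y) p ∈ D p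

end Submanifold

end BronzeLightlike

open BronzeLightlike

/-! Write `c = [X, Y]`. The difference of the two sides of the criterion equals `g(c, Z)`, and a
tangent vector lies in `B` exactly when it is orthogonal to `B'`.

Since the Levi-Civita connection is torsion-free and `J` is parallel, `W = Ω̄_X JY - Ω̄_Y JX` equals
`J c + b`, where `b` collects the `θ`-terms (`connection_along_sub`). For `X, Y` in the
`J`-invariant `B`, both `b` and `J b` lie in `B`, hence are orthogonal to `B'`. The bronze relation
reads `J² - 3J = I`, so pairing `W` with `JZ - 3Z` and moving `J` across by symmetry leaves `g(c,
Z)`.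

It remains to see the induced objects in `g(W, JZ) - 3 g(W, Z)`. As `J` is symmetric and preserves
`Rad TM`, it sends tangent vectors into the orthogonal of `Rad TM`. Thus `W` and `JZ` are orthogonal
to `Rad TM` and have no `ltr(TM)`-part, and `TM ⊥ S(TM^⊥)` gives `g(W, JZ) = g(tan W, fZ) +
g(h^s-part of W, JZ)` and `g(W, Z) = g(tan W, Z)` (`inner_proj_of_eq`).

For the converse, the condition on sections must be tested on each single vector of `B'`;
`exists_isSection_inf_perp` provides global sections through any such vector, up to a nonzero
factor. -/

namespace BronzeLightlike

/-! ### Commutator of directional derivatives of vector-valued functions. -/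

section Calculus

variable {E : Type*} [NormedAddCommGroup E] [NormedSpace ℝ E]
  {F : Type*} [NormedAddCommGroup F] [NormedSpace ℝ F]

/-- The second-derivative terms cancel by symmetry of `D²k`; the derivatives of the fields remain
and form the bracket. -/
theorem fderiv_fderiv_apply_sub {k : F → E} {A B : F → F} {x : F} (hk : ContDiffAt ℝ 2 k x)
    (hA : DifferentiableAt ℝ A x) (hB : DifferentiableAt ℝ B x) :
    fderiv ℝ (fun y ↦ fderiv ℝ k y (B y)) x (A x) - fderiv ℝ (fun y ↦ fderiv ℝ k y (A y)) x (B x) =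
      fderiv ℝ k x (VectorField.lieBracket ℝ A B x) := by
  have hk' : DifferentiableAt ℝ (fderiv ℝ k) x :=
    (hk.fderiv_right (m := 1) (by norm_num)).differentiableAt (by norm_num)
  have hs : IsSymmSndFDerivAt ℝ k x := hk.isSymmSndFDerivAt (by simp)
  rw [fderiv_clm_apply hk' hB, fderiv_clm_apply hk' hA]
  simp [VectorField.lieBracket, hs.eq (A x) (B x)]

variable {M : Type*} [TopologicalSpace M] [ChartedSpace F M] [IsManifold 𝓘(ℝ, F) ∞ M]

/-- The flat identity, transported through the chart at `p`. It is meant for `h` = a chart of `N`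
composed with `i`, which turns it into a statement about coordinates of pushed-forward fields. -/
theorem mvfderiv_mvfderiv_apply_sub [CompleteSpace F] {h : M → E}
    {X Y : ∀ p : M, TangentSpace 𝓘(ℝ, F) p} {p : M} (hh : ContMDiffAt 𝓘(ℝ, F) 𝓘(ℝ, E) 2 h p)
    (hX : MDiffAt (T% X) p) (hY : MDiffAt (T% Y) p) :
    mvfderiv 𝓘(ℝ, F) (fun q ↦ mvfderiv 𝓘(ℝ, F) h q (Y q)) p (X p) -
        mvfderiv 𝓘(ℝ, F) (fun q ↦ mvfderiv 𝓘(ℝ, F) h q (X q)) p (Y p) =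
      mvfderiv 𝓘(ℝ, F) h p (VectorField.mlieBracket 𝓘(ℝ, F) X Y p) := by
  have : IsManifold 𝓘(ℝ, F) 2 M := IsManifold.of_le (n := ∞) (by norm_cast)
  have : IsManifold 𝓘(ℝ, F) 1 M := IsManifold.of_le (n := ∞) (by exact_mod_cast le_top)
  set ψ := extChartAt 𝓘(ℝ, F) p
  set k : F → E := h ∘ ψ.symm
  have hk : ContDiffAt ℝ 2 k (ψ p) := by
    have := (contMDiffAt_iff_source (x := p)).1 hh
    rw [ModelWithCorners.range_eq_univ, contMDiffWithinAt_univ, contMDiffAt_iff_contDiffAt] at this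
    exact this
  -- `P V` is the field `V` read in the chart `ψ`, and `k` is `h` read there.
  let P : (∀ p : M, TangentSpace 𝓘(ℝ, F) p) → F → F := fun V ↦
    VectorField.mpullbackWithin 𝓘(ℝ, F) 𝓘(ℝ, F) ψ.symm V (range 𝓘(ℝ, F))
  have hset : ψ.symm ⁻¹' univ ∩ range 𝓘(ℝ, F) = univ := by simp
  have hP : ∀ V : ∀ p : M, TangentSpace 𝓘(ℝ, F) p, MDiffAt (T% V) p →
      DifferentiableAt ℝ (P V) (ψ p) := by
    intro V hV
    have h1 : DifferentiableWithinAt ℝ (P V) (ψ.symm ⁻¹' univ ∩ range 𝓘(ℝ, F)) (ψ p) :=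
      (mdifferentiableWithinAt_univ.2 hV).differentiableWithinAt_mpullbackWithin_vectorField
    rwa [hset, differentiableWithinAt_univ] at h1
  have hψd : ∀ q ∈ ψ.source, MDifferentiableAt 𝓘(ℝ, F) 𝓘(ℝ, F) ψ q := fun q hq ↦
    mdifferentiableAt_extChartAt (by rwa [← extChartAt_source 𝓘(ℝ, F)])
  have hPψ : ∀ (V : ∀ p : M, TangentSpace 𝓘(ℝ, F) p), ∀ q ∈ ψ.source,
      P V (ψ q) = mfderiv 𝓘(ℝ, F) 𝓘(ℝ, F) ψ q (V q) := by
    intro V q hq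
    have h1 : P V (ψ q) = mfderiv 𝓘(ℝ, F) 𝓘(ℝ, F) ψ (ψ.symm (ψ q)) (V (ψ.symm (ψ q))) :=
      congrArg (fun A ↦ A (V (ψ.symm (ψ q)))) (ContinuousLinearMap.inverse_eq
        (mfderivWithin_extChartAt_symm_comp_mfderiv_extChartAt (ψ.map_source hq))
        (mfderiv_extChartAt_comp_mfderivWithin_extChartAt_symm (ψ.map_source hq)))
    have h2 : ∀ q', q' = q → (mfderiv 𝓘(ℝ, F) 𝓘(ℝ, F) ψ q' (V q') : F) =
        mfderiv 𝓘(ℝ, F) 𝓘(ℝ, F) ψ q (V q) := by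
      rintro _ rfl; rfl
    exact h1.trans (h2 _ (ψ.left_inv hq))
  have hkd : ∀ᶠ q in 𝓝 p, DifferentiableAt ℝ k (ψ q) := by
    have h1 : ∀ᶠ y in 𝓝 (ψ p), ContDiffAt ℝ 2 k y := hk.eventually (by simp)
    have h2 : ContinuousAt ψ p := continuousAt_extChartAt p
    filter_upwards [h2.eventually h1] with q hq
    exact hq.differentiableAt (by norm_num)
  have hsrc : ∀ᶠ q in 𝓝 p, q ∈ ψ.source := extChartAt_source_mem_nhds p
  have hchain : ∀ (f : F → E) (u : M → E) (q : M) (v : TangentSpace 𝓘(ℝ, F) q), q ∈ ψ.source →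
      DifferentiableAt ℝ f (ψ q) → (u =ᶠ[𝓝 q] f ∘ ψ) →
      mvfderiv 𝓘(ℝ, F) u q v = fderiv ℝ f (ψ q) (mfderiv 𝓘(ℝ, F) 𝓘(ℝ, F) ψ q v) := by
    intro f u q v hq hf hu
    have h1 := mfderiv_comp q hf.mdifferentiableAt (hψd q hq)
    rw [← hu.mfderiv_eq, mfderiv_eq_fderiv] at h1
    exact congrArg (fun A ↦ A v) h1
  have hG : ∀ V : ∀ p : M, TangentSpace 𝓘(ℝ, F) p,
      (fun q ↦ mvfderiv 𝓘(ℝ, F) h q (V q)) =ᶠ[𝓝 p] (fun y ↦ fderiv ℝ k y (P V y)) ∘ ψ := by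
    intro V
    filter_upwards [hkd, hsrc] with q hq hq'
    rw [hchain k h q (V q) hq' hq, Function.comp_apply, hPψ V q hq']
    filter_upwards [extChartAt_source_mem_nhds' hq'] with y hy
    simp [k, ψ.left_inv hy]
  have hp : p ∈ ψ.source := mem_extChartAt_source p
  have hk' : DifferentiableAt ℝ (fderiv ℝ k) (ψ p) :=
    (hk.fderiv_right (m := 1) (by norm_num)).differentiableAt (by norm_num)
  rw [hchain _ _ p (X p) hp (hk'.clm_apply (hP Y hY)) (hG Y),
    hchain _ _ p (Y p) hp (hk'.clm_apply (hP X hX)) (hG X), ← hPψ X p hp, ← hPψ Y p hp,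
    fderiv_fderiv_apply_sub hk (hP X hX) (hP Y hY),
    hchain k h p _ hp (hk.differentiableAt (by norm_num)) ?_]
  · congr 1
    -- The manifold bracket is the inverse chart derivative applied to the bracket of the chart
    -- representatives; applying the chart derivative cancels that inverse.
    rw [← VectorField.mlieBracketWithin_univ, VectorField.mlieBracketWithin_apply]
    refine Eq.trans ?_ ((isInvertible_mfderiv_extChartAt (I := 𝓘(ℝ, F)) hp).self_apply_inverse
      _).symm
    rw [← VectorField.lieBracketWithin_univ, ← hset]
  · filter_upwards [hsrc] with y hy
    simp [k, ψ.left_inv hy]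
end Calculus

/-! ### The pullback connection: torsion identity along `i`, and the `(l,m)`-correction. -/

section Pullback

variable {E : Type*} [NormedAddCommGroup E] [NormedSpace ℝ E] [FiniteDimensional ℝ E]
  {N : Type*} [TopologicalSpace N] [ChartedSpace E N] [IsManifold 𝓘(ℝ, E) ∞ N]
  {F : Type*} [NormedAddCommGroup F] [NormedSpace ℝ F] [FiniteDimensional ℝ F]
  {M : Type*} [TopologicalSpace M] [ChartedSpace F M] [IsManifold 𝓘(ℝ, F) ∞ M]

omit [FiniteDimensional ℝ E] [FiniteDimensional ℝ F] [IsManifold 𝓘(ℝ, F) ∞ M] in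
theorem mvfderiv_congr_of_eventuallyEq {f g : M → E} {p : M} (h : f =ᶠ[𝓝 p] g) :
    mvfderiv 𝓘(ℝ, F) f p = mvfderiv 𝓘(ℝ, F) g p := by
  ext v
  exact congrArg (fun A ↦ A v) (h.mfderiv_eq (I := 𝓘(ℝ, F)) (I' := 𝓘(ℝ, E)))

omit [FiniteDimensional ℝ E] in
theorem trivializationAt_snd_eq_mvfderiv {x y : N} (hy : y ∈ (extChartAt 𝓘(ℝ, E) x).source)
    (w : TangentSpace 𝓘(ℝ, E) y) :
    (trivializationAt E (TangentSpace 𝓘(ℝ, E) : N → Type _) x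
      (⟨y, w⟩ : TangentBundle 𝓘(ℝ, E) N)).2 = mvfderiv 𝓘(ℝ, E) (extChartAt 𝓘(ℝ, E) x) y w := by
  rw [extChartAt_source] at hy
  have h := TangentBundle.continuousLinearMapAt_trivializationAt (I := 𝓘(ℝ, E)) hy
  have h2 : y ∈ (trivializationAt E (TangentSpace 𝓘(ℝ, E) : N → Type _) x).baseSet := hy
  have h3 := congrArg (fun A ↦ A w) h
  refine Eq.trans ?_ h3
  rw [Trivialization.continuousLinearMapAt_apply, Trivialization.coe_linearMapAt_of_mem _ h2]

omit [FiniteDimensional ℝ E] [FiniteDimensional ℝ F] [IsManifold 𝓘(ℝ, F) ∞ M] in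
theorem trivializationAt_push_eventuallyEq {i : M → N} (hi : ContMDiff 𝓘(ℝ, F) 𝓘(ℝ, E) ∞ i)
    (Y : ∀ p : M, TangentSpace 𝓘(ℝ, F) p) (p : M) :
    (fun q ↦ (trivializationAt E (TangentSpace 𝓘(ℝ, E) : N → Type _) (i p)
      (⟨i q, push E i Y q⟩ : TangentBundle 𝓘(ℝ, E) N)).2) =ᶠ[𝓝 p]
    fun q ↦ mvfderiv 𝓘(ℝ, F) (extChartAt 𝓘(ℝ, E) (i p) ∘ i) q (Y q) := by
  filter_upwards [hi.continuous.continuousAt.preimage_mem_nhds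
    (extChartAt_source_mem_nhds (I := 𝓘(ℝ, E)) (i p))] with q hq
  rw [trivializationAt_snd_eq_mvfderiv hq]
  have h := mfderiv_comp q (mdifferentiableAt_extChartAt (I := 𝓘(ℝ, E))
    (by rwa [mem_preimage, extChartAt_source] at hq)) (hi.mdifferentiableAt (x := q) (by simp))
  exact congrArg (fun A ↦ A (Y q)) h.symm

omit [FiniteDimensional ℝ E] in
-- The trivialization of `TN` at `i p` is the derivative of the chart there, so the coordinates of
-- `push Y` are the derivative of chart ∘ `i` along `Y`, and the commutator formula applies.
theorem trivializationAt_push_sub {i : M → N} (hi : ContMDiff 𝓘(ℝ, F) 𝓘(ℝ, E) ∞ i)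
    {X Y : ∀ p : M, TangentSpace 𝓘(ℝ, F) p} {p : M}
    (hX : MDiffAt (T% X) p) (hY : MDiffAt (T% Y) p) :
    mvfderiv 𝓘(ℝ, F) (fun q ↦ (trivializationAt E (TangentSpace 𝓘(ℝ, E) : N → Type _) (i p)
        (⟨i q, push E i Y q⟩ : TangentBundle 𝓘(ℝ, E) N)).2) p (X p) -
      mvfderiv 𝓘(ℝ, F) (fun q ↦ (trivializationAt E (TangentSpace 𝓘(ℝ, E) : N → Type _) (i p)
        (⟨i q, push E i X q⟩ : TangentBundle 𝓘(ℝ, E) N)).2) p (Y p) =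
    (trivializationAt E (TangentSpace 𝓘(ℝ, E) : N → Type _) (i p)
      (⟨i p, push E i (VectorField.mlieBracket 𝓘(ℝ, F) X Y) p⟩ : TangentBundle 𝓘(ℝ, E) N)).2 := by
  have : CompleteSpace F := FiniteDimensional.complete ℝ F
  have h : ContMDiffAt 𝓘(ℝ, F) 𝓘(ℝ, E) 2 (extChartAt 𝓘(ℝ, E) (i p) ∘ i) p :=
    ((contMDiffAt_extChartAt (n := ∞)).comp p hi.contMDiffAt).of_le (by norm_cast)
  rw [mvfderiv_congr_of_eventuallyEq (trivializationAt_push_eventuallyEq hi X p),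
    mvfderiv_congr_of_eventuallyEq (trivializationAt_push_eventuallyEq hi Y p),
    mvfderiv_mvfderiv_apply_sub h hX hY]
  exact (trivializationAt_push_eventuallyEq hi _ p).self_of_nhds.symm

omit [FiniteDimensional ℝ E] in
theorem trivializationAt_extend_eventuallyEq {x : N} (v : TangentSpace 𝓘(ℝ, E) x) :
    (fun y ↦ (trivializationAt E (TangentSpace 𝓘(ℝ, E) : N → Type _) x
      (⟨y, FiberBundle.extend E v y⟩ : TangentBundle 𝓘(ℝ, E) N)).2) =ᶠ[𝓝 x]
    fun _ ↦ (trivializationAt E (TangentSpace 𝓘(ℝ, E) : N → Type _) x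
      (⟨x, v⟩ : TangentBundle 𝓘(ℝ, E) N)).2 := by
  filter_upwards [(trivializationAt E (TangentSpace 𝓘(ℝ, E) : N → Type _) x).open_baseSet.mem_nhds
    (FiberBundle.mem_baseSet_trivializationAt' x)] with y hy
  simp [FiberBundle.extend, Trivialization.apply_mk_symm _ hy]

omit [FiniteDimensional ℝ F] [IsManifold 𝓘(ℝ, F) ∞ M] in
theorem push_id (X : ∀ p : M, TangentSpace 𝓘(ℝ, F) p) : push F (id : M → M) X = X := by
  ext p
  simp only [push, mfderiv_id]
  rfl

/-- The previous identity for the identity map: the extensions have constant coordinates, so both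
derivatives vanish. This removes the bracket when torsion is evaluated on extensions. -/
theorem mlieBracket_extend (x : N) (v w : TangentSpace 𝓘(ℝ, E) x) :
    VectorField.mlieBracket 𝓘(ℝ, E) (FiberBundle.extend E v) (FiberBundle.extend E w) x = 0 := by
  have hx := FiberBundle.mem_baseSet_trivializationAt' (F := E)
    (E := (TangentSpace 𝓘(ℝ, E) : N → Type _)) x
  have h := trivializationAt_push_sub (i := (id : N → N)) contMDiff_id
    (FiberBundle.mdifferentiableAt_extend 𝓘(ℝ, E) E v)
    (FiberBundle.mdifferentiableAt_extend 𝓘(ℝ, E) E w)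
  have hc : ∀ u : TangentSpace 𝓘(ℝ, E) x,
      (fun q ↦ (trivializationAt E (TangentSpace 𝓘(ℝ, E) : N → Type _) x
        (⟨q, push E id (FiberBundle.extend E u) q⟩ : TangentBundle 𝓘(ℝ, E) N)).2) =ᶠ[𝓝 x]
      fun _ ↦ (trivializationAt E (TangentSpace 𝓘(ℝ, E) : N → Type _) x
        (⟨x, u⟩ : TangentBundle 𝓘(ℝ, E) N)).2 := by
    intro u
    filter_upwards [trivializationAt_extend_eventuallyEq u] with q hq
    rw [congrFun (push_id _) q]
    exact hq
  have h' := h.symm.trans (congrArg₂ (· - ·)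
    (congrArg (fun A ↦ A (FiberBundle.extend E v x)) (mvfderiv_congr_of_eventuallyEq (hc w)))
    (congrArg (fun A ↦ A (FiberBundle.extend E w x)) (mvfderiv_congr_of_eventuallyEq (hc v))))
  simp only [mvfderiv_const, zero_apply, sub_zero] at h'
  rw [congrFun (push_id _) x] at h'
  have h2 := Trivialization.symm_apply_apply_mk
    (trivializationAt E (TangentSpace 𝓘(ℝ, E) : N → Type _) x) hx
    (VectorField.mlieBracket 𝓘(ℝ, E) (FiberBundle.extend E v) (FiberBundle.extend E w) x)
  rw [← h2]
  refine (congrArg _ h').trans ?_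
  rw [← Trivialization.symmL_apply (R := ℝ) _ hx, map_zero]

/-- The coordinate derivatives contribute the bracket; the remaining connection terms, taken on
constant-coordinate extensions, cancel because the torsion vanishes and those extensions commute. -/
theorem pullbackConnection_push_sub {nabla : Connection E N} (hn : nabla.torsion = 0) {i : M → N}
    (hi : ContMDiff 𝓘(ℝ, F) 𝓘(ℝ, E) ∞ i)
    {X Y : ∀ p : M, TangentSpace 𝓘(ℝ, F) p} {p : M}
    (hX : MDiffAt (T% X) p) (hY : MDiffAt (T% Y) p) :
    pullbackConnection nabla i (push E i Y) p (X p) -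
      pullbackConnection nabla i (push E i X) p (Y p) =
    push E i (VectorField.mlieBracket 𝓘(ℝ, F) X Y) p := by
  have h1 := nabla.torsion_apply_eq_extend (push E i X p) (push E i Y p)
  rw [hn, mlieBracket_extend, FiberBundle.extend_apply_self, FiberBundle.extend_apply_self,
    sub_zero] at h1
  have hx := FiberBundle.mem_baseSet_trivializationAt' (F := E)
    (E := (TangentSpace 𝓘(ℝ, E) : N → Type _)) (i p)
  have h2 := congrArg ((trivializationAt E (TangentSpace 𝓘(ℝ, E) : N → Type _) (i p)).symmL ℝ (i p))
    (trivializationAt_push_sub hi hX hY)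
  rw [map_sub, Trivialization.symmL_apply (R := ℝ) _ hx, Trivialization.symmL_apply (R := ℝ) _ hx,
    Trivialization.symmL_apply (R := ℝ) _ hx, Trivialization.symm_apply_apply_mk _ hx] at h2
  rw [← h2]
  refine (add_sub_add_comm _ _ _ _).trans ?_
  refine (congrArg₂ (· + ·) ?_ h1.symm).trans (add_zero _)
  simp [Trivialization.symmL_apply (R := ℝ) _ hx]

omit [FiniteDimensional ℝ F] [IsManifold 𝓘(ℝ, F) ∞ M] in
theorem pullbackConnection_connection {g : SemiRiemannianMetric E N} (d : LMData E N g)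
    (J : EndField E N) (nabla : Connection E N) (i : M → N) (V : FieldAlong E i) (p : M)
    (v : TangentSpace 𝓘(ℝ, F) p) :
    pullbackConnection (d.connection J nabla) i V p v =
      pullbackConnection nabla i V p v + g.inner (i p) (V p) (d.eta (i p)) •
        (d.l (i p) • mfderiv 𝓘(ℝ, F) 𝓘(ℝ, E) i p v +
          d.m (i p) • J (i p) (mfderiv 𝓘(ℝ, F) 𝓘(ℝ, E) i p v)) := by
  have := d.connection_apply J nabla (FiberBundle.extend E (V p)) (i p)
    (mfderiv 𝓘(ℝ, F) 𝓘(ℝ, E) i p v)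
  rw [FiberBundle.extend_apply_self] at this
  exact (congrArg (_ + ·) this).trans (add_assoc _ _ _).symm

end Pullback

/-! ### Parallelism of `J` for derivatives along `i`. -/

section Parallel

variable {E : Type*} [NormedAddCommGroup E] [NormedSpace ℝ E] [FiniteDimensional ℝ E]
  {N : Type*} [TopologicalSpace N] [ChartedSpace E N] [IsManifold 𝓘(ℝ, E) ∞ N]
  {F : Type*} [NormedAddCommGroup F] [NormedSpace ℝ F] [FiniteDimensional ℝ F]
  {M : Type*} [TopologicalSpace M] [ChartedSpace F M] [IsManifold 𝓘(ℝ, F) ∞ M]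

omit [FiniteDimensional ℝ E] [FiniteDimensional ℝ F] [IsManifold 𝓘(ℝ, F) ∞ M] in
theorem mvfderiv_clm_apply {A : M → E →L[ℝ] E} {u : M → E} {p : M}
    (hA : MDifferentiableAt 𝓘(ℝ, F) 𝓘(ℝ, E →L[ℝ] E) A p)
    (hu : MDifferentiableAt 𝓘(ℝ, F) 𝓘(ℝ, E) u p) (v : TangentSpace 𝓘(ℝ, F) p) :
    mvfderiv 𝓘(ℝ, F) (fun q ↦ A q (u q)) p v =
      mvfderiv 𝓘(ℝ, F) A p v (u p) + A p (mvfderiv 𝓘(ℝ, F) u p v) := by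
  have h1 := hA.hasMFDerivAt
  have h2 := hu.hasMFDerivAt
  -- The product rule is applied in the chart, so values appear at the chart image of `p` pulled
  -- back; this identifies that point with `p`.
  have hp : (extChartAt 𝓘(ℝ, F) p).symm (extChartAt 𝓘(ℝ, F) p p) = p := extChartAt_to_inv p
  have h3 : HasFDerivWithinAt (fun y ↦ A ((extChartAt 𝓘(ℝ, F) p).symm y)
      (u ((extChartAt 𝓘(ℝ, F) p).symm y))) _ (range 𝓘(ℝ, F)) (extChartAt 𝓘(ℝ, F) p p) :=
    HasFDerivWithinAt.clm_apply h1.2 h2.2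
  have h4 : HasMFDerivAt 𝓘(ℝ, F) 𝓘(ℝ, E) (fun q ↦ A q (u q)) p _ :=
    ⟨h1.1.clm_apply h2.1, h3⟩
  refine (congrArg (fun B ↦ B v) h4.mfderiv).trans ?_
  simp only [hp]
  exact add_comm _ _

/-- The endomorphism field `J` in the trivialization of the tangent bundle around `x`. -/
noncomputable def EndField.inTrivialization (J : EndField E N) (x y : N) : E →L[ℝ] E :=
  ContinuousLinearMap.inCoordinates E (TangentSpace 𝓘(ℝ, E) : N → Type _) E
    (TangentSpace 𝓘(ℝ, E) : N → Type _) x y x y (J y)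

omit [FiniteDimensional ℝ E] in
theorem EndField.mdifferentiableAt_inTrivialization (J : EndField E N) (x : N) :
    MDifferentiableAt 𝓘(ℝ, E) 𝓘(ℝ, E →L[ℝ] E) (J.inTrivialization x) x :=
  ((contMDiffAt_hom_bundle _).1 (J.contMDiff x)).2.mdifferentiableAt (by simp)

omit [FiniteDimensional ℝ E] in
theorem EndField.inTrivialization_apply (J : EndField E N) {x y : N}
    (hy : y ∈ (trivializationAt E (TangentSpace 𝓘(ℝ, E) : N → Type _) x).baseSet)
    (w : TangentSpace 𝓘(ℝ, E) y) :
    J.inTrivialization x y (trivializationAt E (TangentSpace 𝓘(ℝ, E) : N → Type _) x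
      (⟨y, w⟩ : TangentBundle 𝓘(ℝ, E) N)).2 =
    (trivializationAt E (TangentSpace 𝓘(ℝ, E) : N → Type _) x
      (⟨y, J y w⟩ : TangentBundle 𝓘(ℝ, E) N)).2 := by
  rw [EndField.inTrivialization, ContinuousLinearMap.inCoordinates_eq hy hy]
  simp only [ContinuousLinearMap.comp_apply, ContinuousLinearEquiv.coe_coe]
  have h := ((trivializationAt E (TangentSpace 𝓘(ℝ, E) : N → Type _) x).continuousLinearEquivAt ℝ y
    hy).symm_apply_apply w
  exact congrArg (fun a ↦ ((trivializationAt E (TangentSpace 𝓘(ℝ, E) : N → Type _)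
    x).continuousLinearEquivAt ℝ y hy) (J y a)) h

omit [FiniteDimensional ℝ F] [IsManifold 𝓘(ℝ, F) ∞ M] in
-- In the trivialization `J` is a matrix field `A`. Differentiating `A u` gives an extra term `dA ·
-- u`; the constant-coordinate extension `C` of `V p` produces the same term when `∇(JC) = J ∇C` is
-- expanded, so the two match. No extension of `V` itself to `N` is needed.
theorem pullbackConnection_along {g : SemiRiemannianMetric E N} {J : EndField E N}
    {nabla : Connection E N} (hN : IsLocallyBronze g J nabla) {i : M → N} {V : FieldAlong E i}
    {p : M} (hV : MDifferentiableAt 𝓘(ℝ, F) 𝓘(ℝ, E).tangent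
      (fun q ↦ (⟨i q, V q⟩ : TangentBundle 𝓘(ℝ, E) N)) p) (v : TangentSpace 𝓘(ℝ, F) p) :
    pullbackConnection nabla i (J.along V) p v = J (i p) (pullbackConnection nabla i V p v) := by
  obtain ⟨hi, hu⟩ := (mdifferentiableAt_totalSpace _ _ ).1 hV
  simp only at hi hu
  set e := trivializationAt E (TangentSpace 𝓘(ℝ, E) : N → Type _) (i p) with he
  have hx : i p ∈ e.baseSet := FiberBundle.mem_baseSet_trivializationAt' (i p)
  set A := J.inTrivialization (i p) with hA
  have hAd : MDifferentiableAt 𝓘(ℝ, E) 𝓘(ℝ, E →L[ℝ] E) A (i p) :=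
    J.mdifferentiableAt_inTrivialization (i p)
  set v' := mfderiv 𝓘(ℝ, F) 𝓘(ℝ, E) i p v with hv'
  set u : M → E := fun q ↦ (e (⟨i q, V q⟩ : TangentBundle 𝓘(ℝ, E) N)).2
  have e1 : (fun q ↦ (e (⟨i q, J.along V q⟩ : TangentBundle 𝓘(ℝ, E) N)).2) =ᶠ[𝓝 p]
      fun q ↦ A (i q) (u q) := by
    filter_upwards [hi.continuousAt.preimage_mem_nhds (e.open_baseSet.mem_nhds hx)] with q hq
    exact (J.inTrivialization_apply hq _).symm
  have e2 : mvfderiv 𝓘(ℝ, F) (fun q ↦ A (i q)) p v = mvfderiv 𝓘(ℝ, E) A (i p) v' :=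
    congrArg (fun B ↦ B v) (mfderiv_comp p hAd hi)
  have e3 : mvfderiv 𝓘(ℝ, F) (fun q ↦ (e (⟨i q, J.along V q⟩ : TangentBundle 𝓘(ℝ, E) N)).2) p v =
      mvfderiv 𝓘(ℝ, E) A (i p) v' (u p) + A (i p) (mvfderiv 𝓘(ℝ, F) u p v) := by
    rw [mvfderiv_congr_of_eventuallyEq e1, ← e2]
    exact mvfderiv_clm_apply (A := fun q ↦ A (i q)) (hAd.comp p hi) hu v
  set C := FiberBundle.extend E (V p) with hC
  have hCd : MDiffAt (T% C) (i p) := FiberBundle.mdifferentiableAt_extend 𝓘(ℝ, E) E (V p)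
  have hWd : MDiffAt (T% (fun y ↦ J y (C y))) (i p) :=
    (J.contMDiff.mdifferentiableAt (by simp)).clm_bundle_apply hCd
  have f1 : (fun y ↦ (e (⟨y, J y (C y)⟩ : TangentBundle 𝓘(ℝ, E) N)).2) =ᶠ[𝓝 (i p)]
      fun y ↦ A y (u p) := by
    filter_upwards [e.open_baseSet.mem_nhds hx, trivializationAt_extend_eventuallyEq (V p)]
      with y hy hy'
    rw [← J.inTrivialization_apply hy]
    exact congrArg (A y) hy'
  have f2 : mvfderiv 𝓘(ℝ, E) (fun y ↦ (e (⟨y, J y (C y)⟩ : TangentBundle 𝓘(ℝ, E) N)).2) (i p) v' =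
      mvfderiv 𝓘(ℝ, E) A (i p) v' (u p) := by
    rw [mvfderiv_congr_of_eventuallyEq f1, mvfderiv_clm_apply hAd mdifferentiableAt_const,
      mvfderiv_const]
    simp
  have hid : mfderiv 𝓘(ℝ, E) 𝓘(ℝ, E) (id : N → N) (i p) v' = v' := by
    rw [mfderiv_id]
    rfl
  -- `JC` does not have constant coordinates. `pullbackConnection_comp` for the identity map splits
  -- `∇(JC)` into its coordinate derivative and the derivative of the extension of its value.
  have f3 : e.symmL ℝ (i p)
      (mvfderiv 𝓘(ℝ, E) (fun y ↦ (e (⟨y, J y (C y)⟩ : TangentBundle 𝓘(ℝ, E) N)).2) (i p) v') +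
        nabla (FiberBundle.extend E (J (i p) (C (i p)))) (i p)
          (mfderiv 𝓘(ℝ, E) 𝓘(ℝ, E) (id : N → N) (i p) v') =
      nabla (fun y ↦ J y (C y)) (i p) (mfderiv 𝓘(ℝ, E) 𝓘(ℝ, E) (id : N → N) (i p) v') :=
    congrArg (fun B ↦ B v') (pullbackConnection_comp nabla (id : N → N)
      (fun y ↦ J y (C y)) (i p) mdifferentiableAt_id hWd)
  rw [hid, f2, hN.parallel C (i p) v' hCd, hC, FiberBundle.extend_apply_self] at f3
  have f4 : e.symmL ℝ (i p) (A (i p) (mvfderiv 𝓘(ℝ, F) u p v)) =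
      J (i p) (e.symmL ℝ (i p) (mvfderiv 𝓘(ℝ, F) u p v)) := by
    rw [hA, Trivialization.symmL_apply (R := ℝ) _ hx, Trivialization.symmL_apply (R := ℝ) _ hx]
    have h1 := J.inTrivialization_apply hx (e.symm (i p) (mvfderiv 𝓘(ℝ, F) u p v))
    rw [← he, e.apply_mk_symm hx] at h1
    rw [h1, e.symm_apply_apply_mk hx]
  have f5 : pullbackConnection nabla i (J.along V) p v =
      e.symmL ℝ (i p) (mvfderiv 𝓘(ℝ, F)
        (fun q ↦ (e (⟨i q, J.along V q⟩ : TangentBundle 𝓘(ℝ, E) N)).2) p v) +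
        nabla (FiberBundle.extend E (J (i p) (V p))) (i p) v' := rfl
  have f6 : pullbackConnection nabla i V p v =
      e.symmL ℝ (i p) (mvfderiv 𝓘(ℝ, F) u p v) + nabla C (i p) v' := rfl
  rw [f5, f6, e3, map_add, map_add, f4, ← f3]
  abel

end Parallel

/-! ### Smooth sections along `i`, and sections through a given vector. -/

section Sections

variable {E : Type*} [NormedAddCommGroup E] [NormedSpace ℝ E] [FiniteDimensional ℝ E]
  {N : Type*} [TopologicalSpace N] [ChartedSpace E N] [IsManifold 𝓘(ℝ, E) ∞ N]
  {F : Type*} [NormedAddCommGroup F] [NormedSpace ℝ F] [FiniteDimensional ℝ F]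
  {M : Type*} [TopologicalSpace M] [ChartedSpace F M] [IsManifold 𝓘(ℝ, F) ∞ M]

omit [FiniteDimensional ℝ E] [FiniteDimensional ℝ F] [IsManifold 𝓘(ℝ, F) ∞ M] in
-- The index type is arbitrary so that `Unit`, `Empty` and `Option` give scalar multiples, the zero
-- section and sums with one distinguished term.
theorem contMDiffAt_sum_smul_along {i : M → N} {q : M} {ι : Type*} {t : Finset ι}
    {c : ι → M → ℝ} {s : ι → FieldAlong E i} (hi : ContMDiffAt 𝓘(ℝ, F) 𝓘(ℝ, E) ∞ i q)
    (hc : ∀ j, ContMDiffAt 𝓘(ℝ, F) 𝓘(ℝ, ℝ) ∞ (c j) q)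
    (hs : ∀ j, ContMDiffAt 𝓘(ℝ, F) 𝓘(ℝ, E).tangent ∞
      (fun p ↦ (⟨i p, s j p⟩ : TangentBundle 𝓘(ℝ, E) N)) q) :
    ContMDiffAt 𝓘(ℝ, F) 𝓘(ℝ, E).tangent ∞
      (fun p ↦ (⟨i p, ∑ j ∈ t, c j p • s j p⟩ : TangentBundle 𝓘(ℝ, E) N)) q := by
  refine (contMDiffAt_totalSpace (F := E) (E := (TangentSpace 𝓘(ℝ, E) : N → Type _))).2 ⟨hi, ?_⟩
  set e := trivializationAt E (TangentSpace 𝓘(ℝ, E) : N → Type _) (i q) with he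
  have hx : i q ∈ e.baseSet := FiberBundle.mem_baseSet_trivializationAt' (i q)
  have h1 : ContMDiffAt 𝓘(ℝ, F) 𝓘(ℝ, E) ∞
      (fun p ↦ ∑ j ∈ t, c j p • (e (⟨i p, s j p⟩ : TangentBundle 𝓘(ℝ, E) N)).2) q :=
    ContMDiffAt.sum fun j _ ↦ (hc j).smul
      ((contMDiffAt_totalSpace (F := E) (E := (TangentSpace 𝓘(ℝ, E) : N → Type _))).1 (hs j)).2
  refine h1.congr_of_eventuallyEq ?_
  filter_upwards [hi.continuousAt.preimage_mem_nhds (e.open_baseSet.mem_nhds hx)] with p hp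
  have h2 : ∀ w : TangentSpace 𝓘(ℝ, E) (i p),
      (e (⟨i p, w⟩ : TangentBundle 𝓘(ℝ, E) N)).2 = e.continuousLinearMapAt ℝ (i p) w := fun w ↦ by
    rw [Trivialization.continuousLinearMapAt_apply, Trivialization.coe_linearMapAt_of_mem _ hp]
  simp only [h2, map_sum, map_smul]

omit [FiniteDimensional ℝ E] [FiniteDimensional ℝ F] [IsManifold 𝓘(ℝ, F) ∞ M] in
theorem contMDiffAt_inner_along (g : SemiRiemannianMetric E N) {i : M → N} {V W : FieldAlong E i}
    {q : M} (hi : ContMDiffAt 𝓘(ℝ, F) 𝓘(ℝ, E) ∞ i q)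
    (hV : ContMDiffAt 𝓘(ℝ, F) 𝓘(ℝ, E).tangent ∞
      (fun p ↦ (⟨i p, V p⟩ : TangentBundle 𝓘(ℝ, E) N)) q)
    (hW : ContMDiffAt 𝓘(ℝ, F) 𝓘(ℝ, E).tangent ∞
      (fun p ↦ (⟨i p, W p⟩ : TangentBundle 𝓘(ℝ, E) N)) q) :
    ContMDiffAt 𝓘(ℝ, F) 𝓘(ℝ, ℝ) ∞ (fun p ↦ g.inner (i p) (V p) (W p)) q := by
  have : ContMDiffAt 𝓘(ℝ, F) (𝓘(ℝ, E).prod 𝓘(ℝ)) ∞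
      (fun m ↦ TotalSpace.mk' ℝ (E := Bundle.Trivial N ℝ) (i m) (g.inner (i m) (V m) (W m))) q := by
    apply ContMDiffAt.clm_bundle_apply₂ (F₁ := E) (F₂ := E)
      (E₁ := (TangentSpace 𝓘(ℝ, E) : N → Type _)) (E₂ := (TangentSpace 𝓘(ℝ, E) : N → Type _))
    · exact ContMDiffAt.comp q g.contMDiff.contMDiffAt hi
    · exact hV
    · exact hW
  simp only [contMDiffAt_totalSpace] at this
  exact this.2

omit [FiniteDimensional ℝ F] [IsManifold 𝓘(ℝ, F) ∞ M] in
theorem contMDiffAt_det {n : Type*} [Fintype n] [DecidableEq n] {A : M → Matrix n n ℝ} {q : M}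
    (hA : ∀ a b, ContMDiffAt 𝓘(ℝ, F) 𝓘(ℝ, ℝ) ∞ (fun p ↦ A p a b) q) :
    ContMDiffAt 𝓘(ℝ, F) 𝓘(ℝ, ℝ) ∞ (fun p ↦ (A p).det) q := by
  simp only [Matrix.det_apply]
  refine ContMDiffAt.sum fun σ _ ↦ ?_
  have h1 : ContMDiffAt 𝓘(ℝ, F) 𝓘(ℝ, ℝ) ∞ (fun p ↦ ∏ a, A p (σ a) a) q :=
    ContMDiffAt.prod fun a _ ↦ hA _ _
  rcases Int.units_eq_one_or (Equiv.Perm.sign σ) with h | h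
  · simpa [h] using h1
  · simpa [h] using h1.neg

omit [FiniteDimensional ℝ E] in
/-- A vector field along `i` that is smooth near `p` can be multiplied by a bump function. -/
theorem exists_isSmoothAlongOn_univ [T2Space M] {i : M → N} (hi : ContMDiff 𝓘(ℝ, F) 𝓘(ℝ, E) ∞ i)
    {V : FieldAlong E i} {U : Set M} {p : M} (hU : U ∈ 𝓝 p) (hV : IsSmoothAlongOn F V U) :
    ∃ f : M → ℝ, f p = 1 ∧ (∀ q ∉ U, f q = 0) ∧ IsSmoothAlongOn F (fun q ↦ f q • V q) univ := by
  obtain ⟨f, -, hf⟩ := (SmoothBumpFunction.nhds_basis_tsupport (I := 𝓘(ℝ, F)) p).mem_iff.1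
    (interior_mem_nhds.2 hU)
  refine ⟨f, f.eq_one, fun q hq ↦ ?_, fun q _ ↦ ContMDiffAt.contMDiffWithinAt ?_⟩
  · by_contra h
    exact hq (interior_subset (hf (subset_tsupport _ h)))
  by_cases hq : q ∈ tsupport f
  · have := contMDiffAt_sum_smul_along (t := (Finset.univ : Finset Unit)) (c := fun _ ↦ f)
      (s := fun _ ↦ V) (hi q) (fun _ ↦ f.contMDiffAt)
      (fun _ ↦ hV.contMDiffAt (mem_interior_iff_mem_nhds.1 (hf hq)))
    simpa using this
  -- Off the support of the bump function the field is locally the empty sum.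
  · have := contMDiffAt_sum_smul_along (t := (∅ : Finset Empty)) (c := fun _ _ ↦ 0)
      (s := fun _ ↦ V) (hi q) (fun j ↦ j.elim) (fun j ↦ j.elim)
    refine this.congr_of_eventuallyEq ?_
    filter_upwards [(isClosed_tsupport f).isOpen_compl.mem_nhds hq] with y hy
    simp [image_eq_zero_of_notMem_tsupport hy]

omit [FiniteDimensional ℝ E] in
-- A division-free orthogonal projection: extend `z` by constant coefficients to `σ`, then subtract
-- from `det G • σ` the Cramer combination of the frame `b` of `D'`, with `G` its Gram matrix. At
-- `p` the correction vanishes because `z ⊥ D'`, leaving `det G • z`; a bump function globalizes the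
-- result.
theorem exists_isSection_inf_perp [T2Space M] (g : SemiRiemannianMetric E N) {i : M → N}
    (hi : ContMDiff 𝓘(ℝ, F) 𝓘(ℝ, E) ∞ i) {D D' : Distribution E i} (hD : IsSmoothSubbundle F D)
    (hD' : IsSmoothSubbundle F D') (hle : ∀ p, D' p ≤ D p)
    (hnd : ∀ p, Disjoint (D' p) (perp g D' p)) {p : M} {z : TangentSpace 𝓘(ℝ, E) (i p)}
    (hz : z ∈ D p ⊓ perp g D' p) :
    ∃ Z, IsSection F (fun q ↦ D q ⊓ perp g D' q) Z ∧ ∃ c : ℝ, c ≠ 0 ∧ Z p = c • z := by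
  classical
  obtain ⟨U₁, hU₁, k, s, hs, hs'⟩ := hD p
  obtain ⟨U₂, hU₂, m, b, hb, hb'⟩ := hD' p
  have hzs : z ∈ Submodule.span ℝ (range fun j ↦ s j p) := by
    rw [(hs' p (mem_of_mem_nhds hU₁)).2]
    exact hz.1
  obtain ⟨a, ha⟩ := (Submodule.mem_span_range_iff_exists_fun ℝ).1 hzs
  let G : M → Matrix (Fin m) (Fin m) ℝ := fun q ↦ .of fun c d ↦ g.inner (i q) (b c q) (b d q)
  let σ : FieldAlong E i := fun q ↦ ∑ j, a j • s j q
  let w : M → Fin m → ℝ := fun q c ↦ g.inner (i q) (b c q) (σ q)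
  let Z : FieldAlong E i := fun q ↦ (G q).det • σ q - ∑ c, (G q).cramer (w q) c • b c q
  have hU : interior (U₁ ∩ U₂) ∈ 𝓝 p := interior_mem_nhds.2 (Filter.inter_mem hU₁ hU₂)
  have hZ : IsSmoothAlongOn F Z (interior (U₁ ∩ U₂)) := by
    intro q hq
    have hq' := mem_interior_iff_mem_nhds.1 hq
    have hsq := fun j ↦ (hs j).contMDiffAt (Filter.mem_of_superset hq' inter_subset_left)
    have hbq := fun j ↦ (hb j).contMDiffAt (Filter.mem_of_superset hq' inter_subset_right)
    have hσ := contMDiffAt_sum_smul_along (t := Finset.univ) (c := fun j _ ↦ a j) (s := s) (hi q)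
      (fun _ ↦ contMDiffAt_const) hsq
    have hw : ∀ c, ContMDiffAt 𝓘(ℝ, F) 𝓘(ℝ, ℝ) ∞ (fun y ↦ w y c) q := fun c ↦
      contMDiffAt_inner_along g (hi q) (hbq c) hσ
    have hG : ∀ c d, ContMDiffAt 𝓘(ℝ, F) 𝓘(ℝ, ℝ) ∞ (fun y ↦ G y c d) q := fun c d ↦
      contMDiffAt_inner_along g (hi q) (hbq c) (hbq d)
    have hcr : ∀ c, ContMDiffAt 𝓘(ℝ, F) 𝓘(ℝ, ℝ) ∞ (fun y ↦ (G y).cramer (w y) c) q := fun c ↦ by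
      simp only [Matrix.cramer_apply]
      refine contMDiffAt_det fun d d' ↦ ?_
      by_cases h : d' = c
      · simpa [Matrix.updateCol_apply, h] using hw d
      · simpa [Matrix.updateCol_apply, h] using hG d d'
    -- `none` carries `det G • σ`, and `some c` the Cramer term on `b c`.
    have := contMDiffAt_sum_smul_along (t := (Finset.univ : Finset (Option (Fin m))))
      (c := fun j y ↦ j.elim (G y).det fun c ↦ -(G y).cramer (w y) c)
      (s := fun j ↦ j.elim σ b) (hi q)
      (by rintro (_ | c); exacts [contMDiffAt_det hG, (hcr c).neg])
      (by rintro (_ | c); exacts [hσ, hbq c])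
    refine ContMDiffAt.contMDiffWithinAt ?_
    simpa [Fintype.sum_option, Z, sub_eq_add_neg] using this
  have hmem : ∀ q ∈ interior (U₁ ∩ U₂), Z q ∈ D q ⊓ perp g D' q := by
    intro q hq
    have hq' := interior_subset hq
    have hσ : σ q ∈ D q := by
      rw [← (hs' q hq'.1).2]
      exact sum_mem fun j _ ↦ Submodule.smul_mem _ _ (Submodule.subset_span ⟨j, rfl⟩)
    have hbD : ∀ c, b c q ∈ D' q := fun c ↦ by
      rw [← (hb' q hq'.2).2]
      exact Submodule.subset_span ⟨c, rfl⟩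
    refine ⟨sub_mem (Submodule.smul_mem _ _ hσ)
      (sum_mem fun c _ ↦ Submodule.smul_mem _ _ (hle q (hbD c))), fun n hn ↦ ?_⟩
    rw [← (hb' q hq'.2).2] at hn
    change g.inner (i q) n (Z q) = 0
    induction hn using Submodule.span_induction with
    | mem x hx =>
      obtain ⟨c, rfl⟩ := hx
      -- Cramer's identity `G (cramer w) = det G • w` is precisely orthogonality of `Z` to `b c`.
      have h1 := congrFun (Matrix.mulVec_cramer (G q) (w q)) c
      simp only [Matrix.mulVec, dotProduct, Pi.smul_apply, smul_eq_mul, G, w, Matrix.of_apply] at h1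
      simp only [Z, map_sub, map_sum, map_smul, smul_eq_mul, G, w]
      rw [← h1, sub_eq_zero]
      exact Finset.sum_congr rfl fun d _ ↦ mul_comm _ _
    | zero => simp
    | add x y _ _ hx hy => simp [hx, hy]
    | smul c x _ hx => simp [hx]
  have hp := mem_of_mem_nhds hU
  have hp' := interior_subset hp
  -- A kernel vector of the Gram matrix would give a nonzero element of `D' ∩ D'^⊥`.
  have hdet : (G p).det ≠ 0 := by
    intro h
    obtain ⟨v, hv, hv'⟩ := Matrix.exists_mulVec_eq_zero_iff.2 h
    obtain ⟨hli, hsp⟩ := hb' p hp'.2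
    have hn : ∑ c, v c • b c p ∈ D' p := by
      rw [← hsp]
      exact sum_mem fun c _ ↦ Submodule.smul_mem _ _ (Submodule.subset_span ⟨c, rfl⟩)
    have hn' : ∑ c, v c • b c p ∈ perp g D' p := by
      intro x hx
      rw [← hsp] at hx
      change g.inner (i p) x _ = 0
      induction hx using Submodule.span_induction with
      | mem x hx =>
        obtain ⟨c, rfl⟩ := hx
        refine Eq.trans ?_ (congrFun hv' c)
        simp [Matrix.mulVec, dotProduct, G, mul_comm]
      | zero => simp
      | add x y _ _ hx hy => rw [map_add, add_apply, hx, hy, add_zero]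
      | smul c x _ hx => rw [map_smul, smul_apply, hx, smul_zero]
    exact hv (funext (Fintype.linearIndependent_iff.1 hli v
      (Submodule.disjoint_def.1 (hnd p) _ hn hn')))
  have hσp : σ p = z := ha
  have hZp : Z p = (G p).det • z := by
    have hw : w p = 0 := by
      ext c
      simp only [w, hσp]
      refine hz.2 _ ?_
      rw [← (hb' p hp'.2).2]
      exact Submodule.subset_span ⟨c, rfl⟩
    simp [Z, hσp, hw]
  obtain ⟨f, hf1, hf0, hf⟩ := exists_isSmoothAlongOn_univ hi hU hZ
  refine ⟨fun q ↦ f q • Z q, ⟨hf, fun q ↦ ?_⟩, _, hdet, by simp [hf1, hZp]⟩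
  by_cases hq : q ∈ interior (U₁ ∩ U₂)
  · exact Submodule.smul_mem _ _ (hmem q hq)
  · simp [hf0 q hq]

end Sections

/-! ### Pointwise linear algebra of the screen decomposition and of `B`, `B'`. -/

section Screen

variable {E : Type*} [NormedAddCommGroup E] [NormedSpace ℝ E] [FiniteDimensional ℝ E]
  {N : Type*} [TopologicalSpace N] [ChartedSpace E N] [IsManifold 𝓘(ℝ, E) ∞ N]
  {F : Type*} [NormedAddCommGroup F] [NormedSpace ℝ F] [FiniteDimensional ℝ F]
  {M : Type*} [TopologicalSpace M] [ChartedSpace F M] [IsManifold 𝓘(ℝ, F) ∞ M]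
  {g : SemiRiemannianMetric E N} {J : EndField E N} {i : M → N}

namespace ScreenData

omit [FiniteDimensional ℝ E] [FiniteDimensional ℝ F] [IsManifold 𝓘(ℝ, F) ∞ M] in
theorem screen_le_tangent (S : ScreenData F g i) (p : M) : S.screen p ≤ tangent E F i p :=
  S.sup_screen p ▸ le_sup_right

omit [FiniteDimensional ℝ E] [FiniteDimensional ℝ F] [IsManifold 𝓘(ℝ, F) ∞ M] in
theorem screenTrans_le_perp (S : ScreenData F g i) (p : M) :
    S.screenTrans p ≤ perp g (tangent E F i) p :=
  S.sup_screenTrans p ▸ le_sup_right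

theorem inner_tangent_screenTrans (S : ScreenData F g i) {p : M} {v w : TangentSpace 𝓘(ℝ, E) (i p)}
    (hv : v ∈ tangent E F i p) (hw : w ∈ S.screenTrans p) : g.inner (i p) v w = 0 :=
  S.screenTrans_le_perp p hw v hv

/-- Such an `n` is orthogonal to `S(TM)` and `S(TM^⊥)` by construction, to `ltr(TM)` by nullity and
to `Rad TM` by hypothesis, hence to everything. -/
theorem eq_zero_of_mem_ltr (S : ScreenData F g i) {p : M} {n : TangentSpace 𝓘(ℝ, E) (i p)}
    (hn : n ∈ S.ltr p) (hr : ∀ ξ ∈ rad F g i p, g.inner (i p) ξ n = 0) : n = 0 := by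
  refine g.nondegenerate (i p) n fun w ↦ ?_
  rw [g.symm]
  have hn' : n ∈ perp g (fun q ↦ S.screen q ⊔ S.screenTrans q) p :=
    S.sup_ltr p ▸ Submodule.mem_sup_right hn
  obtain ⟨t, ht, u, hu, rfl⟩ := Submodule.mem_sup.1
    ((S.isCompl p).1.sup_eq_top ▸ Submodule.mem_top (x := w))
  rw [← S.sup_screen p] at ht
  obtain ⟨ξ, hξ, s, hs, rfl⟩ := Submodule.mem_sup.1 ht
  obtain ⟨n', hn1, u', hu', rfl⟩ := Submodule.mem_sup.1 hu
  have h1 : g.inner (i p) s n = 0 := hn' s (Submodule.mem_sup_left hs)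
  have h2 : g.inner (i p) u' n = 0 := hn' u' (Submodule.mem_sup_right hu')
  simp only [map_add, add_apply, hr ξ hξ, h1, h2, S.ltr_null p _ hn1 _ hn, add_zero]

/-- `TM` and `S(TM^⊥)` are orthogonal to `Rad TM`, so the `ltr(TM)`-part of `v` is orthogonal to
`Rad TM` too and must vanish. -/
theorem exists_eq_add_of_perp_rad (S : ScreenData F g i) {p : M}
    {v : TangentSpace 𝓘(ℝ, E) (i p)} (hv : ∀ ξ ∈ rad F g i p, g.inner (i p) ξ v = 0) :
    v = S.tanProj p v + S.screenTransProj p v ∧ S.tanProj p v ∈ tangent E F i p ∧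
      S.screenTransProj p v ∈ S.screenTrans p := by
  obtain ⟨t, ht, u, hu, rfl⟩ := Submodule.mem_sup.1
    ((S.isCompl p).1.sup_eq_top ▸ Submodule.mem_top (x := v))
  obtain ⟨n, hn, w, hw, rfl⟩ := Submodule.mem_sup.1 hu
  obtain rfl : n = 0 := S.eq_zero_of_mem_ltr hn fun ξ hξ ↦ by
    have h1 : g.inner (i p) ξ t = 0 := by
      rw [g.symm]
      exact hξ.2 t ht
    have h2 := S.inner_tangent_screenTrans hξ.1 hw
    simpa [h1, h2] using hv ξ hξ
  rw [zero_add]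
  have h1 : S.tanProj p (t + w) = t := by
    rw [map_add]
    refine (congrArg₂ (· + ·) (Submodule.projection_apply_of_mem_left _ ht)
      (Submodule.projection_apply_of_mem_right _ (Submodule.mem_sup_right hw))).trans (add_zero _)
  have h2 : S.screenTransProj p (t + w) = w := by
    rw [map_add]
    refine (congrArg₂ (· + ·) (Submodule.projection_apply_of_mem_right _
      (Submodule.mem_sup_left ht)) (Submodule.projection_apply_of_mem_left _ hw)).trans (zero_add _)
  rw [h1, h2]
  exact ⟨rfl, ht, hw⟩

theorem inner_proj_add_inner_proj (S : ScreenData F g i) {p : M}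
    {v w : TangentSpace 𝓘(ℝ, E) (i p)} (hv : ∀ ξ ∈ rad F g i p, g.inner (i p) ξ v = 0)
    (hw : ∀ ξ ∈ rad F g i p, g.inner (i p) ξ w = 0) :
    g.inner (i p) (S.tanProj p v) (S.tanProj p w) + g.inner (i p) (S.screenTransProj p v) w =
      g.inner (i p) v w := by
  obtain ⟨h1, h2, h3⟩ := S.exists_eq_add_of_perp_rad hv
  obtain ⟨h4, h5, h6⟩ := S.exists_eq_add_of_perp_rad hw
  have h7 := S.inner_tangent_screenTrans h2 h6
  conv_rhs => rw [h1, map_add, add_apply]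
  congr 1
  conv_rhs => rw [h4, map_add, h7, add_zero]

theorem inner_tanProj_of_mem_screen (S : ScreenData F g i) {p : M}
    {v z : TangentSpace 𝓘(ℝ, E) (i p)} (hv : ∀ ξ ∈ rad F g i p, g.inner (i p) ξ v = 0)
    (hz : z ∈ S.screen p) : g.inner (i p) (S.tanProj p v) z = g.inner (i p) v z := by
  obtain ⟨h1, -, h3⟩ := S.exists_eq_add_of_perp_rad hv
  have h := S.inner_tangent_screenTrans (S.screen_le_tangent p hz) h3
  rw [g.symm] at h
  conv_rhs => rw [h1, map_add, add_apply, h, add_zero]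

theorem B_le_tangent (S : ScreenData F g i) (J : EndField E N) (p : M) :
    S.B J p ≤ tangent E F i p :=
  sup_le (inf_le_right.trans (S.screen_le_tangent p)) inf_le_left

theorem inner_B_B' (S : ScreenData F g i) {p : M} {v z : TangentSpace 𝓘(ℝ, E) (i p)}
    (hv : v ∈ S.B J p) (hz : z ∈ S.B' J p) : g.inner (i p) v z = 0 := by
  obtain ⟨b, hb, ξ, hξ, rfl⟩ := Submodule.mem_sup.1 hv
  have h1 : g.inner (i p) b z = 0 := hz.2 b hb
  have h2 : g.inner (i p) ξ z = 0 := by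
    rw [g.symm]
    exact hξ.2 z (S.screen_le_tangent p hz.1)
  rw [map_add, add_apply, h1, h2, add_zero]

omit [FiniteDimensional ℝ E] [FiniteDimensional ℝ F] [IsManifold 𝓘(ℝ, F) ∞ M] in
-- On `B_o`: if `b = J s` with `b, s` in the screen, then `J b = J² s = 3b + s` stays in the screen.
theorem J_mem_B (hJ : IsBronze g J) {S : ScreenData F g i} (hS : S.IsScreenGeneric J) {p : M}
    {v : TangentSpace 𝓘(ℝ, E) (i p)} (hv : v ∈ S.B J p) : J (i p) v ∈ S.B J p := by
  obtain ⟨b, ⟨⟨s, hs, rfl⟩, hb⟩, ξ, hξ, rfl⟩ := Submodule.mem_sup.1 hv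
  rw [map_add]
  refine add_mem (Submodule.mem_sup_left ⟨⟨_, hb, rfl⟩, ?_⟩) (Submodule.mem_sup_right ?_)
  · change J (i p) (J (i p) s) ∈ _
    rw [hJ.sq]
    exact add_mem (Submodule.smul_mem _ _ hb) hs
  · rw [← hS.rad_invariant p]
    exact ⟨ξ, hξ, rfl⟩

/-- Nondegeneracy of `B_o` splits the screen as `B_o ⊥ B'`. The `B'`-component of `c` is orthogonal
to `B'` by assumption and to `B` always, hence to `TM`; it thus lies in `Rad TM ∩ S(TM) = 0`. -/
theorem mem_B_iff {S : ScreenData F g i} (hS : S.IsScreenGeneric J) {p : M}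
    {c : TangentSpace 𝓘(ℝ, E) (i p)} (hc : c ∈ tangent E F i p) :
    c ∈ S.B J p ↔ ∀ z ∈ S.B' J p, g.inner (i p) c z = 0 := by
  refine ⟨fun h z hz ↦ S.inner_B_B' h hz, fun h ↦ ?_⟩
  have : FiniteDimensional ℝ (TangentSpace 𝓘(ℝ, E) (i p)) := inferInstanceAs (FiniteDimensional ℝ E)
  have hr : (g.form (i p)).IsRefl :=
    LinearMap.BilinForm.IsSymm.isRefl ⟨fun v w ↦ g.symm (i p) v w⟩
  have htop := ((LinearMap.BilinForm.isCompl_orthogonal_iff_disjoint hr).2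
    (hS.Bo_nondegenerate p)).sup_eq_top
  rw [← S.sup_screen p] at hc
  obtain ⟨ξ, hξ, s, hs, rfl⟩ := Submodule.mem_sup.1 hc
  obtain ⟨b, hb, b', hb', rfl⟩ := Submodule.mem_sup.1 (htop ▸ Submodule.mem_top (x := s))
  have hb's : b' ∈ S.screen p := by
    simpa using sub_mem hs (show b ∈ S.screen p from hb.2)
  have hbB : b ∈ S.B J p := Submodule.mem_sup_left hb
  have hξB : ξ ∈ S.B J p := Submodule.mem_sup_right hξ
  have h0 : b' = 0 := by
    refine Submodule.disjoint_def.1 (S.disjoint_screen p) b'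
      ⟨S.screen_le_tangent p hb's, fun t ht ↦ ?_⟩ hb's
    rw [← S.sup_screen p] at ht
    obtain ⟨ξ', hξ', s', hs', rfl⟩ := Submodule.mem_sup.1 ht
    obtain ⟨a, ha, a', ha', rfl⟩ := Submodule.mem_sup.1 (htop ▸ Submodule.mem_top (x := s'))
    have ha's : a' ∈ S.screen p := by
      simpa using sub_mem hs' (show a ∈ S.screen p from ha.2)
    have h1 := h a' ⟨ha's, ha'⟩
    have h2 := S.inner_B_B' (add_mem hξB hbB) (J := J) ⟨ha's, ha'⟩
    have h3 := S.inner_B_B' (J := J) (add_mem (Submodule.mem_sup_right hξ')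
      (Submodule.mem_sup_left ha)) ⟨hb's, hb'⟩
    rw [← add_assoc, map_add, add_apply, h2, zero_add, g.symm] at h1
    change g.inner (i p) _ b' = 0
    rw [← add_assoc, map_add, add_apply, h3, h1, add_zero]
  rw [h0, add_zero]
  exact add_mem hξB hbB

/-- The pointwise content of the integrability criterion: `c` stands for `[X, Y]`, and `b` is the
contribution of the one-form `θ` to `Ω_X JY - Ω_Y JX`. -/
theorem inner_proj_of_eq (hJ : IsBronze g J) {S : ScreenData F g i} (hS : S.IsScreenGeneric J)
    {p : M} {c b z : TangentSpace 𝓘(ℝ, E) (i p)} (hc : c ∈ tangent E F i p) (hb : b ∈ S.B J p)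
    (hz : z ∈ S.B' J p) :
    g.inner (i p) (S.tanProj p (J (i p) c + b)) (S.tanProj p (J (i p) z)) +
      g.inner (i p) (S.screenTransProj p (J (i p) c + b)) (J (i p) z) -
      3 * g.inner (i p) (S.tanProj p (J (i p) c + b)) z = g.inner (i p) c z := by
  have hrJ : ∀ t ∈ tangent E F i p, ∀ ξ ∈ rad F g i p, g.inner (i p) ξ (J (i p) t) = 0 := by
    intro t ht ξ hξ
    rw [hJ.compatible, g.symm]
    have : J (i p) ξ ∈ rad F g i p := by
      rw [← hS.rad_invariant p]
      exact ⟨ξ, hξ, rfl⟩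
    exact this.2 t ht
  have hrt : ∀ t ∈ tangent E F i p, ∀ ξ ∈ rad F g i p, g.inner (i p) ξ t = 0 := by
    intro t ht ξ hξ
    rw [g.symm]
    exact hξ.2 t ht
  have hzt := S.screen_le_tangent p hz.1
  have hW : ∀ ξ ∈ rad F g i p, g.inner (i p) ξ (J (i p) c + b) = 0 := fun ξ hξ ↦ by
    rw [map_add, hrJ c hc ξ hξ, hrt b (S.B_le_tangent J p hb) ξ hξ, add_zero]
  -- The left side becomes `g(Jc + b, Jz) - 3 g(Jc + b, z)`. Moving `J` to the first argument and
  -- using `J² c = 3Jc + c` cancels the `Jc` terms; `b` and `Jb` are orthogonal to `z`.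
  rw [S.inner_proj_add_inner_proj hW (hrJ z hzt), S.inner_tanProj_of_mem_screen hW hz.1,
    hJ.compatible, map_add, hJ.sq]
  have h1 := S.inner_B_B' hb hz
  have h2 := S.inner_B_B' (J_mem_B hJ hS hb) hz
  simp only [map_add, add_apply, map_smul, smul_apply, smul_eq_mul, h1, h2]
  ring

end ScreenData

end Screen

/-! ### The derivative identity and the integrability criterion. -/

section Main

variable {E : Type*} [NormedAddCommGroup E] [NormedSpace ℝ E] [FiniteDimensional ℝ E]
  {N : Type*} [TopologicalSpace N] [ChartedSpace E N] [IsManifold 𝓘(ℝ, E) ∞ N]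
  {F : Type*} [NormedAddCommGroup F] [NormedSpace ℝ F] [FiniteDimensional ℝ F]
  {M : Type*} [TopologicalSpace M] [ChartedSpace F M] [IsManifold 𝓘(ℝ, F) ∞ M]

/-- `Ω_X JY - Ω_Y JX = J[X, Y] + θ(JY) (l X + m JX) - θ(JX) (l Y + m JY)`. -/
theorem connection_along_sub {g : SemiRiemannianMetric E N} {J : EndField E N}
    {nabla : Connection E N} (hN : IsLocallyBronze g J nabla) (d : LMData E N g) {i : M → N}
    (hi : ContMDiff 𝓘(ℝ, F) 𝓘(ℝ, E) ∞ i) {X Y : ∀ p : M, TangentSpace 𝓘(ℝ, F) p}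
    (hX : IsSmoothField X) (hY : IsSmoothField Y)
    (hX' : IsSmoothAlongOn F (push E i X) univ) (hY' : IsSmoothAlongOn F (push E i Y) univ)
    (p : M) :
    pullbackConnection (d.connection J nabla) i (J.along (push E i Y)) p (X p) -
        pullbackConnection (d.connection J nabla) i (J.along (push E i X)) p (Y p) =
      J (i p) (push E i (VectorField.mlieBracket 𝓘(ℝ, F) X Y) p) +
        (g.inner (i p) (J (i p) (push E i Y p)) (d.eta (i p)) •
            (d.l (i p) • push E i X p + d.m (i p) • J (i p) (push E i X p)) -
          g.inner (i p) (J (i p) (push E i X p)) (d.eta (i p)) •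
            (d.l (i p) • push E i Y p + d.m (i p) • J (i p) (push E i Y p))) := by
  have hXp := (contMDiffOn_univ.1 hX').mdifferentiableAt (x := p) (by simp)
  have hYp := (contMDiffOn_univ.1 hY').mdifferentiableAt (x := p) (by simp)
  rw [pullbackConnection_connection, pullbackConnection_connection,
    pullbackConnection_along hN hXp, pullbackConnection_along hN hYp,
    ← pullbackConnection_push_sub hN.isLeviCivita.torsion_eq_zero hi
      (hX.mdifferentiableAt (by simp)) (hY.mdifferentiableAt (by simp)), map_sub]
  exact add_sub_add_comm _ _ _ _

end Main

end BronzeLightlike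
theorem mainTheorem6
    {E : Type*} [NormedAddCommGroup E] [NormedSpace ℝ E] [FiniteDimensional ℝ E]
    {N : Type*} [TopologicalSpace N] [T2Space N] [ChartedSpace E N] [IsManifold 𝓘(ℝ, E) ∞ N]
    {F : Type*} [NormedAddCommGroup F] [NormedSpace ℝ F] [FiniteDimensional ℝ F]
    {M : Type*} [TopologicalSpace M] [T2Space M] [ChartedSpace F M] [IsManifold 𝓘(ℝ, F) ∞ M]
    (g : SemiRiemannianMetric E N) (J : EndField E N) (nabla : Connection E N)
    (hN : IsLocallyBronze g J nabla) (d : LMData E N g)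
    (i : M → N) (r : ℕ) (hM : IsLightlike F g i r)
    (S : ScreenData F g i) (hS : S.IsScreenGeneric J) :
    IsIntegrable F (S.B J) ↔
      ∀ X Y : ∀ p : M, TangentSpace 𝓘(ℝ, F) p, IsSmoothField X → IsSmoothField Y →
        IsSection F (S.B J) (push E i X) → IsSection F (S.B J) (push E i Y) →
      ∀ Z : FieldAlong E i, IsSection F (S.B' J) Z → ∀ p : M,
        g.inner (i p) (S.induced (d.connection J nabla) X (J.along (push E i Y)) p)
              (S.f J Z p)
            + g.inner (i p) (S.hs (d.connection J nabla) X (J.along (push E i Y)) p)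
              (J.along Z p)
            + 3 * g.inner (i p) (S.induced (d.connection J nabla) Y (J.along (push E i X)) p) (Z p)
          = g.inner (i p) (S.induced (d.connection J nabla) Y (J.along (push E i X)) p)
              (S.f J Z p)
            + g.inner (i p) (S.hs (d.connection J nabla) Y (J.along (push E i X)) p)
              (J.along Z p)
            + 3 * g.inner (i p) (S.induced (d.connection J nabla) X (J.along (push E i Y)) p)
              (Z p) := by
  have hi : ContMDiff 𝓘(ℝ, F) 𝓘(ℝ, E) ∞ i := hM.isImmersion.contMDiff
  have hJ := hN.isBronze
  -- Only the value `Z p` matters here, so one identity serves both directions.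
  have key : ∀ X Y : ∀ p : M, TangentSpace 𝓘(ℝ, F) p, IsSmoothField X → IsSmoothField Y →
      IsSection F (S.B J) (push E i X) → IsSection F (S.B J) (push E i Y) →
      ∀ (Z : FieldAlong E i) (p : M), Z p ∈ S.B' J p →
      g.inner (i p) (push E i (VectorField.mlieBracket 𝓘(ℝ, F) X Y) p) (Z p) =
        (g.inner (i p) (S.induced (d.connection J nabla) X (J.along (push E i Y)) p)
              (S.f J Z p)
            + g.inner (i p) (S.hs (d.connection J nabla) X (J.along (push E i Y)) p)
              (J.along Z p)
            + 3 * g.inner (i p) (S.induced (d.connection J nabla) Y (J.along (push E i X)) p) (Z p))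
          - (g.inner (i p) (S.induced (d.connection J nabla) Y (J.along (push E i X)) p)
              (S.f J Z p)
            + g.inner (i p) (S.hs (d.connection J nabla) Y (J.along (push E i X)) p)
              (J.along Z p)
            + 3 * g.inner (i p) (S.induced (d.connection J nabla) X (J.along (push E i Y)) p)
              (Z p)) := by
    intro X Y hX hY hXB hYB Z p hZ
    have hb : ∀ (a b : ℝ), ∀ v ∈ S.B J p, a • (d.l (i p) • v + b • J (i p) v) ∈ S.B J p :=
      fun a b v hv ↦ Submodule.smul_mem _ _ (add_mem (Submodule.smul_mem _ _ hv)
        (Submodule.smul_mem _ _ (ScreenData.J_mem_B hJ hS hv)))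
    have h := ScreenData.inner_proj_of_eq hJ hS
      (c := push E i (VectorField.mlieBracket 𝓘(ℝ, F) X Y) p) ⟨_, rfl⟩
      (sub_mem (hb (g.inner (i p) (J (i p) (push E i Y p)) (d.eta (i p))) (d.m (i p)) _ (hXB.2 p))
        (hb (g.inner (i p) (J (i p) (push E i X p)) (d.eta (i p))) (d.m (i p)) _ (hYB.2 p))) hZ
    -- The projections must be applied to the difference: it is orthogonal to `Rad TM`, whereas each
    -- derivative separately may have an `ltr(TM)`-part. Linearity then separates the terms.
    rw [← connection_along_sub hN d hi hX hY hXB.1 hYB.1 p] at h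
    rw [← h]
    simp only [map_sub, sub_apply, ScreenData.induced, ScreenData.hs, ScreenData.f,
      EndField.along]
    ring
  refine ⟨fun h X Y hX hY hXB hYB Z hZ p ↦ ?_, fun h X Y hX hY hXB hYB p ↦ ?_⟩
  · rw [← sub_eq_zero, ← key X Y hX hY hXB hYB Z p (hZ.2 p)]
    exact S.inner_B_B' (h X Y hX hY hXB hYB p) (hZ.2 p)
  · refine (ScreenData.mem_B_iff hS ⟨_, rfl⟩).2 fun z hz ↦ ?_
    -- The hypothesis concerns global smooth sections of `B'`, so `z` is replaced by a section with
    -- value `c • z` at `p`, `c ≠ 0`.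
    obtain ⟨Z, hZ, c, hc, hZp⟩ := exists_isSection_inf_perp g hi S.screen_smooth hS.Bo_smooth
      (fun _ ↦ inf_le_right) hS.Bo_nondegenerate hz
    have h1 := key X Y hX hY hXB hYB Z p (hZ.2 p)
    rw [sub_eq_zero.2 (h X Y hX hY hXB hYB Z hZ p), hZp, map_smul, smul_eq_mul] at h1
    exact (mul_eq_zero.1 h1).resolve_left hc
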